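/- Let $h:\mathbb R\to\mathbb R$ be an even $C^2$ function with $h(0)=h'(0)=h''(0)=0$ such that $h''$ is strictly increasing, unbounded and concave on $[0,\infty)$, and suppose that $$\sum_{n\ge 3}\frac1{h\big(\sqrt{n/\ln\ln n}\big)}<\infty .$$ Let $m\in\mathbb R$, $v\ge 0$, $w\ge 0$ and consider the following game between Skeptic and Reality, in which Forecaster's announcements are constantly $(m,v,w)$. Skeptic's initial capital is $\mathcal K_0=1$. In each round $n=1,2,\dots$ Skeptic announces $M_n,V_n,W_n\in\mathbb R$, then Reality announces $x_n\in\mathbb R$, and $$\mathcal K_n=\mathcal K_{n-1}+M_n(x_n-m)+V_n\big((x_n-m)^2-v\big)+W_n\big(h(x_n-m)-w\big).$$ Assume that the game is coherent, that is, for all $M,V,W\in\mathbb R$ there is $x\in\mathbb R$ with $M(x-m)+V((x-m)^2-v)+W(h(x-m)-w)\le 0$. For a set $E$ of sequences $(x_n)_{n\ge1}$, *Skeptic can force* $E$ if he has a strategy (his moves in round $n$ being a function of $x_1,\dots,x_{n-1}$) such that for every sequence $(x_n)$ one has $\mathcal K_n\ge0$ for all $n$, and $\mathcal K_n\to\infty$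 whenever $(x_n)\notin E$. *Reality can comply with* $E$ if she has a strategy ($x_n$ being a function of Skeptic's moves in rounds $1,\dots,n$) such that for all sequences of moves of Skeptic for which $\mathcal K_n\ge0$ for all $n$, one has $(x_n)\in E$ and $\sup_n\mathcal K_n<\infty$. Put $S_n=\sum_{i=1}^n x_i$. Then for all $m'\in\mathbb R$ and $v'\ge0$ the following are equivalent: 1. $m'=m$ and $v'=v$. 2. Skeptic can force the event $$\limsup_{n\to\infty}\frac{S_n-m'n}{\sqrt{2n\ln\ln n}}=\sqrt{v'} .$$ 3. Reality can comply with this event. -/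

import Mathlib

namespace LILGame

/-- Forecaster's announcement in one round: the price `m` of `x`, the price `v` of the quadratic
hedge `(x - m) ^ 2` and the price `w` of the extra hedge `h (x - m)`. -/
structure Forecast where
  m : ℝ
  v : ℝ
  w : ℝ

/-- Skeptic's announcement in one round: the (possibly negative) numbers of tickets that he buys
on `x - m`, on the quadratic hedge and on the extra hedge. -/
structure SkepticMove where
  M : ℝ
  V : ℝ
  W : ℝ

/-- The conditions imposed on the extra hedge `h`: it is even and of class `C²`, with
`h 0 = h' 0 = h'' 0 = 0`, and `h''` is strictly increasing, unbounded and concave on `[0, ∞)`. -/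
structure IsExtraHedge (h : ℝ → ℝ) : Prop where
  even : Function.Even h
  contDiff : ContDiff ℝ 2 h
  zero : h 0 = 0
  deriv_zero : deriv h 0 = 0
  deriv2_zero : deriv (deriv h) 0 = 0
  strictMonoOn : StrictMonoOn (deriv (deriv h)) (Set.Ici 0)
  unbounded : ¬ BddAbove (deriv (deriv h) '' Set.Ici 0)
  concaveOn : ConcaveOn ℝ (Set.Ici 0) (deriv (deriv h))

/-- Skeptic's gain in one round in which Forecaster, Skeptic and Reality announce `f`, `s`, `x`. -/
def gain (h : ℝ → ℝ) (f : Forecast) (s : SkepticMove) (x : ℝ) : ℝ :=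
  s.M * (x - f.m) + s.V * ((x - f.m) ^ 2 - f.v) + s.W * (h (x - f.m) - f.w)

/-- Skeptic's capital after `n` rounds, starting from `1`. The moves of the `n`-th round,
`n = 1, 2, …`, are `f (n - 1)`, `s (n - 1)`, `x (n - 1)`. -/
def capital (h : ℝ → ℝ) (f : ℕ → Forecast) (s : ℕ → SkepticMove) (x : ℕ → ℝ) : ℕ → ℝ
  | 0 => 1
  | n + 1 => capital h f s x n + gain h (f n) (s n) (x n)

/-- Forecaster's collateral duty: in every round, whatever Skeptic announces, Reality has a move
that does not increase Skeptic's capital. -/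
def Coherent (h : ℝ → ℝ) (f : ℕ → Forecast) : Prop :=
  ∀ (n : ℕ) (s : SkepticMove), ∃ x : ℝ, gain h (f n) s x ≤ 0

/-- A strategy for Skeptic (against known forecasts): his move in each round is a function of
Reality's moves in the previous rounds. -/
abbrev SkepticStrategy : Type := (n : ℕ) → (Fin n → ℝ) → SkepticMove

/-- The moves of Skeptic when he follows the strategy `σ` and Reality plays `x`. -/
def SkepticStrategy.play (σ : SkepticStrategy) (x : ℕ → ℝ) (n : ℕ) : SkepticMove :=
  σ n fun i => x i

/-- A strategy for Reality (against known forecasts): her move in each round is a function of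
Skeptic's moves up to and including this round. -/
abbrev RealityStrategy : Type := (n : ℕ) → (Fin (n + 1) → SkepticMove) → ℝ

/-- The moves of Reality when she follows the strategy `ρ` and Skeptic plays `s`. -/
def RealityStrategy.play (ρ : RealityStrategy) (s : ℕ → SkepticMove) (n : ℕ) : ℝ :=
  ρ n fun i => s i

/-- Skeptic can force the event `E`: he has a strategy that keeps his capital non-negative whatever
Reality does, and that makes it tend to infinity whenever `E` fails. -/
def SkepticCanForce (h : ℝ → ℝ) (f : ℕ → Forecast) (E : Set (ℕ → ℝ)) : Prop :=
  ∃ σ : SkepticStrategy, ∀ x : ℕ → ℝ,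
    (∀ n, 0 ≤ capital h f (σ.play x) x n) ∧
      (x ∈ E ∨ Filter.Tendsto (capital h f (σ.play x) x) Filter.atTop Filter.atTop)

/-- Reality can comply with the event `E`: she has a strategy such that, for all moves of Skeptic
that keep his capital non-negative, `E` happens and Skeptic's capital stays bounded above. -/
def RealityCanComply (h : ℝ → ℝ) (f : ℕ → Forecast) (E : Set (ℕ → ℝ)) : Prop :=
  ∃ ρ : RealityStrategy, ∀ s : ℕ → SkepticMove,
    (∀ n, 0 ≤ capital h f s (ρ.play s) n) →
      ρ.play s ∈ E ∧ BddAbove (Set.range (capital h f s (ρ.play s)))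

/-- The event `limsup (Sₙ - m' n) / √(2 n ln ln n) = √v'`, where `Sₙ` is the sum of the first `n`
moves of Reality; the upper limit is taken in the extended reals. -/
def lilEvent (m' v' : ℝ) : Set (ℕ → ℝ) :=
  {x | Filter.limsup
      (fun n : ℕ => ((((∑ i ∈ Finset.range n, x i) - m' * n) /
        √(2 * n * Real.log (Real.log n)) : ℝ) : EReal)) Filter.atTop = ((√v' : ℝ) : EReal)}

end LILGame

/-! The equivalence reduces to one forcing statement: Skeptic can force the law of the iterated
logarithm with the true parameters `m`, `v`. If Skeptic can force an event, Reality can comply with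
it: she pits herself against the sum of the actual Skeptic and an imaginary forcing one, and
coherence keeps their joint capital at most 2 (`SkepticCanForce.realityCanComply`). If Reality
complies with the event for `m'`, `v'`, playing her against the forcing Skeptic yields a path lying
in both events, and no path has two different normalisations (`eq_of_mem_lilEvent`).

For the forcing statement put `y = x - m`, `L = ln ln n`, `φ = √(2 v n L)`. Betting the fraction
`lam` on `y` and `lam ^ 2 / 2` on `y ^ 2 - v` multiplies the wealth by about `exp (lam * y - lam ^ 2
* v / 2)`, with cubic error. The extra hedge pays for the cubic errors: small bets on it force `∑ h
(y i) / h (jumpBound i) < ∞`, and since `h t / t ^ 3` decreases, this bounds the total error for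
fractions up to the order `√(L / n)` (`exists_log_prod_factor_ge`).

Upper half (`forcesLate_upper`): mix fractions in geometric progression with weights slightly
lighter than `1 / k`. Near time `n` one of them is almost optimal and has weight about `exp (-(1 + δ
/ 2) L)`, while it gains `exp ((1 + δ) L)` whenever the sum exceeds `φ / r`, so the wealth is
unbounded if this happens infinitely often.

Lower half (`forcesLate_lower`): in blocks `[C ^ k, C ^ (k + 1))` sell a slightly suboptimal
exponential strategy, with weight slightly above `1 / ln N`. Buying two neighbouring fractions
covers it: the larger one limits the loss when the sum is large, the smaller one dominates the sold
position when the final sum is small. The hedge covers a single large jump. If the sums stay below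
`(1 - 6 d) φ`, each block earns at least a constant times `1 / k`, and the harmonic series diverges
against summable costs.

For `v = 0` buying `y ^ 2` suffices (`forcesLate_lil_zero`). -/

namespace LILGame

section Proofs

open Filter Topology Finset

/-! ### Linear betting games: mixtures, products, blocks and running maxima -/

section Betting

variable {E : Type*} [NormedAddCommGroup E] [NormedSpace ℝ E]

/-- A process is predictable if its value at time `n` depends on the first `n` outcomes only. -/
def Predictable {α : Type*} (s : ℕ → (ℕ → ℝ) → α) : Prop :=
  ∀ n y z, (∀ i < n, y i = z i) → s n y = s n z

/-- The wealth of a bettor who starts with `1` and bets `s i y` in round `i`, where the bet `b`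
pays `g y b` if the outcome is `y`. -/
def wealth (g : ℝ → E →L[ℝ] ℝ) (s : ℕ → (ℕ → ℝ) → E) (y : ℕ → ℝ) (n : ℕ) : ℝ :=
  1 + ∑ i ∈ range n, g (y i) (s i y)

theorem wealth_zero (g : ℝ → E →L[ℝ] ℝ) (s : ℕ → (ℕ → ℝ) → E) (y : ℕ → ℝ) :
    wealth g s y 0 = 1 := by simp [wealth]

theorem wealth_succ (g : ℝ → E →L[ℝ] ℝ) (s : ℕ → (ℕ → ℝ) → E) (y : ℕ → ℝ) (n : ℕ) :
    wealth g s y (n + 1) = wealth g s y n + g (y n) (s n y) := by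
  simp [wealth, sum_range_succ, add_assoc]

theorem Predictable.apply_eq {α : Type*} {s : ℕ → (ℕ → ℝ) → α} (hs : Predictable s) {n : ℕ}
    {y z : ℕ → ℝ} (h : ∀ i < n, y i = z i) {i : ℕ} (hi : i ≤ n) : s i y = s i z :=
  hs i y z fun j hj => h j (hj.trans_le hi)

theorem Predictable.wealth {g : ℝ → E →L[ℝ] ℝ} {s : ℕ → (ℕ → ℝ) → E} (hs : Predictable s) :
    Predictable fun n y => wealth g s y n := by
  intro n y z h
  simp only [LILGame.wealth]
  congr 1
  refine sum_congr rfl fun i hi => ?_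
  rw [mem_range] at hi
  rw [h i hi, hs.apply_eq h hi.le]

/-- The event `A` can be forced, in the weak sense that the wealth is unbounded if `A` fails, by
non-negative strategies that start betting arbitrarily late. -/
def ForcesLate (g : ℝ → E →L[ℝ] ℝ) (A : Set (ℕ → ℝ)) : Prop :=
  ∀ n₀ : ℕ, ∃ s : ℕ → (ℕ → ℝ) → E, Predictable s ∧ (∀ n < n₀, ∀ y, s n y = 0) ∧
    ∀ y, (∀ n, 0 ≤ wealth g s y n) ∧ (BddAbove (Set.range (wealth g s y)) → y ∈ A)

theorem ForcesLate.mono {g : ℝ → E →L[ℝ] ℝ} {A B : Set (ℕ → ℝ)} (hA : ForcesLate g A)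
    (hAB : A ⊆ B) : ForcesLate g B := fun n₀ => by
  obtain ⟨s, h1, h2, h3⟩ := hA n₀
  exact ⟨s, h1, h2, fun y => ⟨(h3 y).1, fun h => hAB ((h3 y).2 h)⟩⟩

/-- Countable mixtures of strategies. -/
theorem exists_mixture [CompleteSpace E] (g : ℝ → E →L[ℝ] ℝ) {p : ℕ → ℝ} (hp : ∀ k, 0 < p k)
    (hps : Summable p) (s : ℕ → ℕ → (ℕ → ℝ) → E) (hs : ∀ k, Predictable (s k))
    (hb : ∀ n y, ∃ B, ∀ k, ‖s k n y‖ ≤ B) :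
    ∃ t : ℕ → (ℕ → ℝ) → E, Predictable t ∧ (∀ n y, (∀ k, s k n y = 0) → t n y = 0) ∧
      ∀ y n, HasSum (fun k => p k * wealth g (s k) y n) ((∑' k, p k) * wealth g t y n) := by
  have hZ : 0 < ∑' k, p k := hps.tsum_pos (fun k => (hp k).le) 0 (hp 0)
  refine ⟨fun n y => (∑' k, p k)⁻¹ • ∑' k, p k • s k n y, ?_, ?_, ?_⟩
  · intro n y z h
    simp only [hs _ n y z h]
  · intro n y h
    simp [h]
  · intro y n
    induction n with
    | zero => simpa [wealth_zero] using hps.hasSum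
    | succ n ih =>
      obtain ⟨B, hB⟩ := hb n y
      have h1 : Summable fun k => p k • s k n y := by
        refine Summable.of_norm_bounded (hps.mul_right B) fun k => ?_
        rw [norm_smul, Real.norm_of_nonneg (hp k).le]
        exact mul_le_mul_of_nonneg_left (hB k) (hp k).le
      have h2 := (g (y n)).hasSum h1.hasSum
      simp only [wealth_succ, mul_add]
      refine ih.add ?_
      convert h2 using 1
      · ext k; simp
      · simp [mul_inv_cancel_left₀ hZ.ne']

theorem ForcesLate.iInter [CompleteSpace E] {g : ℝ → E →L[ℝ] ℝ} {A : ℕ → Set (ℕ → ℝ)}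
    (hA : ∀ j, ForcesLate g (A j)) : ForcesLate g (⋂ j, A j) := by
  intro n₀
  -- Strategy `j` sleeps until round `j`, so only finitely many of them bet in any given round and
  -- their bets are bounded; this is what late starts are for.
  choose s h1 h2 h3 using fun j => hA j (max n₀ j)
  have hps : Summable fun k : ℕ => (1 / 2 : ℝ) ^ k := summable_geometric_two
  have hp : ∀ k : ℕ, (0 : ℝ) < (1 / 2) ^ k := fun k => by positivity
  obtain ⟨t, t1, t2, t3⟩ := exists_mixture g hp hps s h1 (by
    intro n y
    refine ⟨∑ k ∈ range (n + 1), ‖s k n y‖, fun k => ?_⟩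
    rcases lt_or_ge n k with hk | hk
    · rw [h2 k n (lt_max_of_lt_right hk)]
      simpa using sum_nonneg fun i _ => norm_nonneg _
    · exact single_le_sum (f := fun k => ‖s k n y‖) (fun i _ => norm_nonneg _)
        (mem_range.2 (Nat.lt_succ_of_le hk)))
  have hZ : 0 < ∑' k : ℕ, (1 / 2 : ℝ) ^ k := hps.tsum_pos (fun k => (hp k).le) 0 (hp 0)
  have h0 : ∀ y n, 0 ≤ wealth g t y n := fun y n =>
    nonneg_of_mul_nonneg_right (HasSum.nonneg
      (fun k => mul_nonneg (hp k).le ((h3 k y).1 n)) (t3 y n)) hZ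
  refine ⟨t, t1, fun n hn y => t2 n y fun k => h2 k n (lt_max_of_lt_left hn) y, fun y =>
    ⟨h0 y, ?_⟩⟩
  rintro ⟨B, hB⟩
  refine Set.mem_iInter.2 fun j => (h3 j y).2 ⟨(∑' k : ℕ, (1 / 2 : ℝ) ^ k) * B / (1 / 2) ^ j, ?_⟩
  rintro _ ⟨n, rfl⟩
  rw [le_div_iff₀' (hp j)]
  refine (le_hasSum (t3 y n) j fun k _ => mul_nonneg (hp k).le ((h3 k y).1 n)).trans ?_
  exact mul_le_mul_of_nonneg_left (hB ⟨n, rfl⟩) hZ.le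

theorem ForcesLate.inter [CompleteSpace E] {g : ℝ → E →L[ℝ] ℝ} {A B : Set (ℕ → ℝ)}
    (hA : ForcesLate g A) (hB : ForcesLate g B) : ForcesLate g (A ∩ B) := by
  refine (ForcesLate.iInter (A := fun j => if j = 0 then A else B) fun j => ?_).mono fun y hy => ?_
  · by_cases hj : j = 0 <;> simp [hj, hA, hB]
  · rw [Set.mem_iInter] at hy
    exact ⟨by simpa using hy 0, by simpa using hy 1⟩

/-- Betting fixed multiples of the current wealth. -/
theorem exists_wealth_eq_prod (g : ℝ → E →L[ℝ] ℝ) {r : ℕ → (ℕ → ℝ) → E} (hr : Predictable r) :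
    Predictable (fun n y => (∏ i ∈ range n, (1 + g (y i) (r i y))) • r n y) ∧
      ∀ y n, wealth g (fun n y => (∏ i ∈ range n, (1 + g (y i) (r i y))) • r n y) y n =
        ∏ i ∈ range n, (1 + g (y i) (r i y)) := by
  constructor
  · intro n y z h
    simp only
    rw [hr n y z h]
    congr 1
    refine prod_congr rfl fun i hi => ?_
    rw [mem_range] at hi
    rw [h i hi, hr.apply_eq h hi.le]
  · intro y n
    induction n with
    | zero => simp [wealth]
    | succ n ih =>
      rw [wealth_succ, ih, prod_range_succ]
      simp
      ring

/-- Strategies that are played in consecutive blocks of rounds, each block starting anew with the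
whole current wealth. Round `n` belongs to the block that starts with round `c n`. -/
theorem exists_wealth_blocks (g : ℝ → E →L[ℝ] ℝ) {s : ℕ → (ℕ → ℝ) → E} (hs : Predictable s)
    (c : ℕ → ℕ)
    (hpos : ∀ y n, 0 < 1 + ∑ i ∈ Ico (c n) n, g (y i) (s i y))
    (hpos' : ∀ y n, 0 < 1 + ∑ i ∈ Ico (c n) (n + 1), g (y i) (s i y)) (hc : ∀ n, c n ≤ n) :
    ∃ t : ℕ → (ℕ → ℝ) → E, Predictable t ∧ (∀ n y, s n y = 0 → t n y = 0) ∧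
      (∀ y n, 0 < wealth g t y n) ∧
      ∀ y a b, a ≤ b → (∀ n ∈ Ico a b, c n = a) →
        wealth g t y b = wealth g t y a * (1 + ∑ i ∈ Ico a b, g (y i) (s i y)) := by
  -- `G` is the wealth made in the current block from a unit stake. Dividing by it turns absolute
  -- bets into fractions, and the resulting growth factors telescope within a block.
  let G : ℕ → (ℕ → ℝ) → ℝ := fun n y => 1 + ∑ i ∈ Ico (c n) n, g (y i) (s i y)
  let r : ℕ → (ℕ → ℝ) → E := fun n y => (G n y)⁻¹ • s n y
  have hr : Predictable r := by
    intro n y z h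
    simp only [r, G]
    rw [hs n y z h]
    congr 3
    refine sum_congr rfl fun i hi => ?_
    rw [mem_Ico] at hi
    rw [h i hi.2, hs.apply_eq h hi.2.le]
  have hfac : ∀ y n, 1 + g (y n) (r n y) =
      (1 + ∑ i ∈ Ico (c n) (n + 1), g (y i) (s i y)) / G n y := by
    intro y n
    have h1 : G n y ≠ 0 := (hpos y n).ne'
    rw [sum_Ico_succ_top (hc n), ← add_assoc, eq_div_iff h1]
    simp only [r, map_smul, smul_eq_mul]
    field_simp
    rfl
  obtain ⟨h1, h2⟩ := exists_wealth_eq_prod g hr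
  have hf : ∀ y n, 0 < 1 + g (y n) (r n y) := fun y n => by
    rw [hfac]; exact div_pos (hpos' y n) (hpos y n)
  refine ⟨_, h1, fun n y h => by simp [r, h], fun y n => ?_, fun y a b hab hcb => ?_⟩
  · rw [h2]; exact prod_pos fun i _ => hf y i
  · simp only [h2]
    rw [← prod_range_mul_prod_Ico _ hab]
    congr 1
    induction b, hab using Nat.le_induction with
    | base => simp
    | succ b hab ih =>
      have hb : c b = a := hcb b (by simp [hab])
      rw [prod_Ico_succ_top hab, ih fun n hn => hcb n (by
        rw [mem_Ico] at hn ⊢; omega), hfac]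
      have h1 : G b y = 1 + ∑ i ∈ Ico a b, g (y i) (s i y) := by simp only [G, hb]
      have h0 := (hpos y b).ne'
      rw [hb] at h0 ⊢
      rw [h1]
      field_simp

/-- Dividing the bets by the running maximum of the wealth turns an unbounded wealth into one that
tends to infinity. -/
theorem exists_tendsto_of_unbounded {g : ℝ → E →L[ℝ] ℝ} {s : ℕ → (ℕ → ℝ) → E}
    (hs : Predictable s) (h0 : ∀ y n, 0 ≤ wealth g s y n) :
    ∃ t : ℕ → (ℕ → ℝ) → E, Predictable t ∧ (∀ y n, 0 ≤ wealth g t y n) ∧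
      ∀ y, ¬ BddAbove (Set.range (wealth g s y)) → Tendsto (wealth g t y) atTop atTop := by
  let K : (ℕ → ℝ) → ℕ → ℝ := fun y => partialSups (wealth g s y)
  have hK1 : ∀ y n, 1 ≤ K y n := fun y n => by
    have := le_partialSups_of_le (wealth g s y) (Nat.zero_le n)
    rwa [wealth_zero] at this
  have hKs : ∀ y n, K y (n + 1) = max (K y n) (wealth g s y (n + 1)) := fun y n =>
    partialSups_add_one _ n
  have hKp : Predictable fun n y => K y n := by
    intro n y z h
    have : ∀ i ≤ n, wealth g s y i = wealth g s z i := fun i hi => hs.wealth.apply_eq h hi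
    simp only [K]
    have h' : ∀ i ≤ n, partialSups (wealth g s y) i = partialSups (wealth g s z) i := by
      intro i
      induction i with
      | zero => intro hi; simpa using this 0 hi
      | succ i ih =>
        intro hi
        rw [partialSups_add_one, partialSups_add_one, ih (by omega), this _ hi]
    exact h' n le_rfl
  let t : ℕ → (ℕ → ℝ) → E := fun n y => (K y n)⁻¹ • s n y
  -- While the maximum `K` stands still both sides move equally; when it rises to a new record, `log
  -- u ≤ u - 1` pays for the growth of `log K`.
  have key : ∀ y n, Real.log (K y n) + wealth g s y n / K y n ≤ wealth g t y n := by
    intro y n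
    induction n with
    | zero => simp [K, wealth_zero]
    | succ n ih =>
      have hk : 0 < K y n := zero_lt_one.trans_le (hK1 y n)
      rw [wealth_succ g t]
      have h1 : g (y n) (t n y) = (wealth g s y (n + 1) - wealth g s y n) / K y n := by
        rw [wealth_succ]; simp [t]; field_simp
      rw [h1, hKs]
      rcases le_total (wealth g s y (n + 1)) (K y n) with h | h
      · rw [max_eq_left h, sub_div]; linarith
      · rw [max_eq_right h]
        have h2 := Real.log_le_sub_one_of_pos (div_pos (hk.trans_le h) hk)
        rw [Real.log_div (hk.trans_le h).ne' hk.ne'] at h2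
        rw [div_self (hk.trans_le h).ne', sub_div]
        linarith
  have key' : ∀ y n, Real.log (K y n) ≤ wealth g t y n := fun y n =>
    le_trans (le_add_of_nonneg_right
      (div_nonneg (h0 y n) (zero_le_one.trans (hK1 y n)))) (key y n)
  refine ⟨t, ?_, fun y n => (Real.log_nonneg (hK1 y n)).trans (key' y n), fun y hy => ?_⟩
  · intro n y z h
    simp only [t]
    rw [hs n y z h, show K y n = K z n from hKp n y z h]
  · refine tendsto_atTop_mono (key' y) (Real.tendsto_log_atTop.comp ?_)
    refine tendsto_atTop_atTop_of_monotone (partialSups (wealth g s y)).monotone fun b => ?_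
    by_contra hb
    push Not at hb
    refine hy ⟨b, ?_⟩
    rintro _ ⟨n, rfl⟩
    exact (le_partialSups (wealth g s y) n).trans (hb n).le

end Betting

/-! ### From centred betting to Skeptic's strategies -/

/-- The payoff of the tickets `b` on `y`, `y ^ 2 - v` and `h y - w`. -/
noncomputable def payoff (h : ℝ → ℝ) (v w y : ℝ) : (ℝ × ℝ × ℝ) →L[ℝ] ℝ :=
  y • ContinuousLinearMap.fst ℝ ℝ (ℝ × ℝ) +
    ((y ^ 2 - v) • (ContinuousLinearMap.fst ℝ ℝ ℝ).comp (ContinuousLinearMap.snd ℝ ℝ (ℝ × ℝ)) +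
    (h y - w) • (ContinuousLinearMap.snd ℝ ℝ ℝ).comp (ContinuousLinearMap.snd ℝ ℝ (ℝ × ℝ)))

theorem payoff_apply (h : ℝ → ℝ) (v w y : ℝ) (b : ℝ × ℝ × ℝ) :
    payoff h v w y b = b.1 * y + b.2.1 * (y ^ 2 - v) + b.2.2 * (h y - w) := by
  simp [payoff]; ring

theorem skepticCanForce_of_forcesLate {h : ℝ → ℝ} {m v w : ℝ} {A : Set (ℕ → ℝ)}
    (hA : ForcesLate (payoff h v w) A) :
    SkepticCanForce h (fun _ => ⟨m, v, w⟩) {x | (fun i => x i - m) ∈ A} := by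
  obtain ⟨s, s1, -, s3⟩ := hA 0
  obtain ⟨t, t1, t2, t3⟩ := exists_tendsto_of_unbounded s1 fun y => (s3 y).1
  -- The padding by `0` is never seen, because `t` is predictable.
  let e : (n : ℕ) → (Fin n → ℝ) → ℕ → ℝ := fun n u i => if hi : i < n then u ⟨i, hi⟩ - m else 0
  let σ : SkepticStrategy := fun n u => ⟨(t n (e n u)).1, (t n (e n u)).2.1, (t n (e n u)).2.2⟩
  have hcap : ∀ x : ℕ → ℝ, capital h (fun _ => ⟨m, v, w⟩) (σ.play x) x =
      wealth (payoff h v w) t fun i => x i - m := by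
    intro x
    funext n
    induction n with
    | zero => simp [wealth, capital]
    | succ n ih =>
      have h1 : t n (e n fun i => x i) = t n fun i => x i - m :=
        t1 _ _ _ fun i hi => by simp [e, hi]
      rw [wealth_succ, capital, ih, payoff_apply]
      simp only [gain, SkepticStrategy.play, σ, h1]
  refine ⟨σ, fun x => ?_⟩
  rw [hcap]
  refine ⟨t2 _, ?_⟩
  by_cases hx : (fun i => x i - m) ∈ A
  · exact Or.inl hx
  · exact Or.inr (t3 _ fun hb => hx ((s3 _).2 hb))

/-! ### Reality against a forcing Skeptic -/

/-- The sum of two moves of Skeptic. -/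
def SkepticMove.add (s t : SkepticMove) : SkepticMove := ⟨s.M + t.M, s.V + t.V, s.W + t.W⟩

theorem gain_add (h : ℝ → ℝ) (f : Forecast) (s t : SkepticMove) (x : ℝ) :
    gain h f (s.add t) x = gain h f s x + gain h f t x := by
  simp only [gain, SkepticMove.add]; ring

/-- Reality's answers to the moves `s` of Skeptic that do not increase the joint capital of `s` and
of a Skeptic with strategy `σ`. -/
noncomputable def answers {h : ℝ → ℝ} {f : ℕ → Forecast} (hf : Coherent h f) (σ : SkepticStrategy)
    (s : ℕ → SkepticMove) (n : ℕ) : ℝ :=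
  (hf n ((s n).add (σ n fun i => answers hf σ s i))).choose
termination_by n
decreasing_by all_goals exact i.2

theorem gain_answers {h : ℝ → ℝ} {f : ℕ → Forecast} (hf : Coherent h f) (σ : SkepticStrategy)
    (s : ℕ → SkepticMove) (n : ℕ) :
    gain h (f n) (s n) (answers hf σ s n) +
      gain h (f n) (σ.play (answers hf σ s) n) (answers hf σ s n) ≤ 0 := by
  rw [← gain_add]
  have := (hf n ((s n).add (σ n fun i => answers hf σ s i))).choose_spec
  rw [← answers] at this
  exact this

theorem answers_congr {h : ℝ → ℝ} {f : ℕ → Forecast} (hf : Coherent h f) (σ : SkepticStrategy)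
    {s t : ℕ → SkepticMove} (n : ℕ) (hst : ∀ i ≤ n, s i = t i) :
    answers hf σ s n = answers hf σ t n := by
  induction n using Nat.strong_induction_on with
  | _ n ih =>
    have h1 : (fun i : Fin n => answers hf σ s i) = fun i : Fin n => answers hf σ t i :=
      funext fun i => ih i i.2 fun j hj => hst j (hj.trans i.2.le)
    have h2 := answers.eq_1 hf σ s n
    have h3 := answers.eq_1 hf σ t n
    simp only [h1, hst n le_rfl] at h2
    rw [h2, h3]

/-- The two capitals start with sum 2 and their sum never increases. As both are non-negative, both
are at most 2, so the forcing Skeptic does not become infinitely rich and `E` must happen. -/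
theorem SkepticCanForce.realityCanComply {h : ℝ → ℝ} {f : ℕ → Forecast} {E : Set (ℕ → ℝ)}
    (hE : SkepticCanForce h f E) (hf : Coherent h f) : RealityCanComply h f E := by
  obtain ⟨σ, hσ⟩ := hE
  let ρ : RealityStrategy := fun n u =>
    answers hf σ (fun i => if hi : i < n + 1 then u ⟨i, hi⟩ else ⟨0, 0, 0⟩) n
  have hρ : ∀ s : ℕ → SkepticMove, ρ.play s = answers hf σ s := by
    intro s
    funext n
    exact answers_congr hf σ n fun i hi => by simp [Nat.lt_succ_of_le hi]
  refine ⟨ρ, fun s hs => ?_⟩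
  rw [hρ] at hs ⊢
  set x := answers hf σ s with hx
  have hsum : ∀ n, capital h f s x n + capital h f (σ.play x) x n ≤ 2 := by
    intro n
    induction n with
    | zero => norm_num [capital]
    | succ n ih =>
      have := gain_answers hf σ s n
      rw [← hx] at this
      simp only [capital]
      linarith
  obtain ⟨h1, h2⟩ := hσ x
  constructor
  · refine h2.resolve_right fun h3 => ?_
    obtain ⟨n, hn⟩ := (h3.eventually_gt_atTop 2).exists
    linarith [hsum n, hs n]
  · refine ⟨2, ?_⟩
    rintro _ ⟨n, rfl⟩
    linarith [hsum n, h1 n]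

/-- The moves of a Skeptic with strategy `σ` against a Reality with strategy `ρ`. -/
def encounter (σ : SkepticStrategy) (ρ : RealityStrategy) (n : ℕ) : SkepticMove :=
  σ n fun i => ρ i fun j => encounter σ ρ j
termination_by n
decreasing_by exact lt_of_le_of_lt (Nat.le_of_lt_succ j.2) i.2

/-- In the encounter of the two strategies compliance keeps the capital bounded, which rules out the
other alternative of forcing. -/
theorem RealityCanComply.exists_mem_inter {h : ℝ → ℝ} {f : ℕ → Forecast} {E E' : Set (ℕ → ℝ)}
    (hE' : RealityCanComply h f E') (hE : SkepticCanForce h f E) : ∃ x, x ∈ E ∧ x ∈ E' := by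
  obtain ⟨ρ, hρ⟩ := hE'
  obtain ⟨σ, hσ⟩ := hE
  have hs : σ.play (ρ.play (encounter σ ρ)) = encounter σ ρ := by
    funext n
    rw [encounter]
    rfl
  obtain ⟨h1, h2⟩ := hσ (ρ.play (encounter σ ρ))
  rw [hs] at h1 h2
  obtain ⟨h3, B, hB⟩ := hρ _ h1
  refine ⟨_, h2.resolve_right fun h4 => ?_, h3⟩
  obtain ⟨n, hn⟩ := (h4.eventually_gt_atTop B).exists
  exact absurd (hB ⟨n, rfl⟩) (not_le.2 hn)

/-! ### Growth of the iterated logarithm and uniqueness of the parameters -/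

theorem tendsto_log_log_natCast_atTop :
    Tendsto (fun n : ℕ => Real.log (Real.log n)) atTop atTop :=
  Real.tendsto_log_atTop.comp (Real.tendsto_log_atTop.comp tendsto_natCast_atTop_atTop)

theorem tendsto_log_log_pow_div_natCast (k : ℕ) :
    Tendsto (fun n : ℕ => Real.log (Real.log n) ^ k / n) atTop (𝓝 0) := by
  have h1 : Tendsto (fun n : ℕ => Real.log n ^ k / (n : ℝ)) atTop (𝓝 0) :=
    (Real.isLittleO_pow_log_id_atTop (n := k)).tendsto_div_nhds_zero.comp tendsto_natCast_atTop_atTop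
  refine tendsto_of_tendsto_of_tendsto_of_le_of_le' tendsto_const_nhds h1 ?_ ?_
  · filter_upwards [tendsto_log_log_natCast_atTop.eventually_ge_atTop 0] with n hn
    positivity
  · filter_upwards [tendsto_log_log_natCast_atTop.eventually_ge_atTop 0,
      eventually_ge_atTop 1] with n hn h1
    have : Real.log (Real.log n) ≤ Real.log n :=
      Real.log_le_self (Real.log_nonneg (by exact_mod_cast h1))
    gcongr

theorem tendsto_natCast_div_sqrt_log_log :
    Tendsto (fun n : ℕ => (n : ℝ) / √(2 * n * Real.log (Real.log n))) atTop atTop := by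
  have h1 : Tendsto (fun n : ℕ => (Real.log (Real.log n) / n)) atTop (𝓝[>] 0) := by
    refine tendsto_nhdsWithin_iff.2 ⟨by simpa using tendsto_log_log_pow_div_natCast 1, ?_⟩
    filter_upwards [tendsto_log_log_natCast_atTop.eventually_gt_atTop 0,
      eventually_ge_atTop 1] with n hn h1
    have : (0 : ℝ) < n := by exact_mod_cast h1
    exact div_pos hn this
  have h2 := Real.tendsto_sqrt_atTop.comp
    ((tendsto_inv_nhdsGT_zero.comp h1).const_mul_atTop (show (0 : ℝ) < 1 / 2 by norm_num))
  refine h2.congr' ?_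
  filter_upwards [tendsto_log_log_natCast_atTop.eventually_gt_atTop 0,
      eventually_ge_atTop 1] with n hn h1
  have hn' : (0 : ℝ) < n := by exact_mod_cast h1
  rw [eq_div_iff (by positivity)]
  simp only [Function.comp_apply]
  rw [← Real.sqrt_mul (by positivity), Real.sqrt_eq_iff_mul_self_eq (by positivity) hn'.le]
  field_simp

theorem limsup_ne_of_tendsto_sub_atTop {u u' : ℕ → ℝ} (h : Tendsto (fun n => u' n - u n) atTop atTop)
    {a a' : ℝ} (hu : limsup (fun n => (u n : EReal)) atTop = a)
    (hu' : limsup (fun n => (u' n : EReal)) atTop = a') : False := by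
  have h1 : ∃ᶠ n in atTop, ((a - 1 : ℝ) : EReal) < u n :=
    frequently_lt_of_lt_limsup (by isBoundedDefault)
      (by rw [hu]; exact_mod_cast sub_one_lt a)
  have h2 : ∀ᶠ n in atTop, (u' n : EReal) < ((a' + 1 : ℝ) : EReal) :=
    eventually_lt_of_limsup_lt (by rw [hu']; exact_mod_cast lt_add_one a')
  obtain ⟨n, hn1, hn2, hn3⟩ :=
    (h1.and_eventually (h2.and (h.eventually_gt_atTop (a' + 1 - (a - 1))))).exists
  have hn1' : a - 1 < u n := by exact_mod_cast hn1
  have hn2' : u' n < a' + 1 := by exact_mod_cast hn2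
  linarith

/-- Changing the centring shifts the normalised sums by a multiple of `n / √(2 n ln ln n)`, which
diverges, so both upper limits cannot be finite. With equal centrings the upper limits themselves
coincide. -/
theorem eq_of_mem_lilEvent {x : ℕ → ℝ} {m m' v v' : ℝ} (hv : 0 ≤ v) (hv' : 0 ≤ v')
    (hx : x ∈ lilEvent m v) (hx' : x ∈ lilEvent m' v') : m' = m ∧ v' = v := by
  have key : ∀ a b : ℝ, b < a → Tendsto (fun n : ℕ =>
      ((∑ i ∈ range n, x i) - b * n) / √(2 * n * Real.log (Real.log n)) -
      ((∑ i ∈ range n, x i) - a * n) / √(2 * n * Real.log (Real.log n))) atTop atTop := by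
    intro a b hab
    refine (tendsto_natCast_div_sqrt_log_log.const_mul_atTop (sub_pos.2 hab)).congr fun n => ?_
    ring
  simp only [lilEvent, Set.mem_ofPred_eq] at hx hx'
  have hm : m' = m := by
    rcases lt_trichotomy m' m with h | h | h
    · exact (limsup_ne_of_tendsto_sub_atTop (key _ _ h) hx hx').elim
    · exact h
    · exact (limsup_ne_of_tendsto_sub_atTop (key _ _ h) hx' hx).elim
  subst hm
  refine ⟨rfl, ?_⟩
  rw [hx] at hx'
  exact (Real.sqrt_inj hv' hv).1 (by exact_mod_cast hx'.symm)

theorem tfae_of_skepticCanForce {h : ℝ → ℝ} {m v w : ℝ} (hv : 0 ≤ v)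
    (hcoh : Coherent h fun _ => ⟨m, v, w⟩)
    (hforce : SkepticCanForce h (fun _ => ⟨m, v, w⟩) (lilEvent m v)) {m' v' : ℝ} (hv' : 0 ≤ v') :
    List.TFAE [
      m' = m ∧ v' = v,
      SkepticCanForce h (fun _ => ⟨m, v, w⟩) (lilEvent m' v'),
      RealityCanComply h (fun _ => ⟨m, v, w⟩) (lilEvent m' v')] := by
  tfae_have 1 → 2 := by rintro ⟨rfl, rfl⟩; exact hforce
  tfae_have 2 → 3 := fun h2 => h2.realityCanComply hcoh
  tfae_have 3 → 1 := fun h3 => by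
    obtain ⟨x, hx, hx'⟩ := h3.exists_mem_inter hforce
    exact eq_of_mem_lilEvent hv hv' hx hx'
  tfae_finish

/-! ### The extra hedge grows between quadratically and cubically -/

theorem nonneg_of_deriv2_nonneg {F F₁ F₂ : ℝ → ℝ} (h1 : ∀ t, HasDerivAt F (F₁ t) t)
    (h2 : ∀ t, HasDerivAt F₁ (F₂ t) t) (h0 : F 0 = 0) (h0' : F₁ 0 = 0)
    (hn : ∀ t, 0 < t → 0 ≤ F₂ t) {t : ℝ} (ht : 0 ≤ t) : 0 ≤ F t := by
  have key : ∀ {G G₁ : ℝ → ℝ}, (∀ t, HasDerivAt G (G₁ t) t) → G 0 = 0 → (∀ t, 0 < t → 0 ≤ G₁ t) →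
      ∀ t, 0 ≤ t → 0 ≤ G t := by
    intro G G₁ hG hG0 hG1 t ht
    have : MonotoneOn G (Set.Ici 0) := monotoneOn_of_deriv_nonneg (convex_Ici 0)
      (fun x _ => (hG x).continuousAt.continuousWithinAt)
      (fun x _ => (hG x).differentiableAt.differentiableWithinAt) fun x hx => by
        rw [interior_Ici] at hx
        rw [(hG x).deriv]
        exact hG1 x hx
    simpa [hG0] using this (Set.mem_Ici.2 le_rfl) (Set.mem_Ici.2 ht) ht
  exact key h1 h0 (fun t ht => key h2 h0' hn t ht.le) t ht

namespace IsExtraHedge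

variable {h : ℝ → ℝ} (hh : IsExtraHedge h)
include hh

theorem hasDerivAt (t : ℝ) : HasDerivAt h (deriv h t) t :=
  ((hh.contDiff.differentiable (by norm_num)) t).hasDerivAt

theorem hasDerivAt_deriv (t : ℝ) : HasDerivAt (deriv h) (deriv (deriv h) t) t := by
  have h1 : ContDiff ℝ (1 + 1) h := by
    have := hh.contDiff
    rwa [show (2 : WithTop ℕ∞) = 1 + 1 by norm_num] at this
  exact (((contDiff_succ_iff_deriv.1 h1).2.2.differentiable (by norm_num)) t).hasDerivAt

theorem hasDerivAt_comp_mul (c t : ℝ) :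
    HasDerivAt (fun t => h (c * t)) (c * deriv h (c * t)) t := by
  exact ((hh.hasDerivAt (c * t)).comp t ((hasDerivAt_id t).const_mul c)).congr_deriv
    (by rw [mul_one, mul_comm])

theorem hasDerivAt_deriv_comp_mul (c t : ℝ) :
    HasDerivAt (fun t => c * deriv h (c * t)) (c ^ 2 * deriv (deriv h) (c * t)) t := by
  exact (((hh.hasDerivAt_deriv (c * t)).comp t ((hasDerivAt_id t).const_mul c)).const_mul
    c).congr_deriv (by ring)

/-- Concavity and `h'' 0 = 0` give `c * h'' t ≤ h'' (c * t)`; integrate twice. In other words, `h t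
/ t ^ 3` is nonincreasing. -/
theorem pow_three_mul_le {c t : ℝ} (hc : 0 ≤ c) (hc1 : c ≤ 1) (ht : 0 ≤ t) :
    c ^ 3 * h t ≤ h (c * t) := by
  have := nonneg_of_deriv2_nonneg (F := fun t => h (c * t) - c ^ 3 * h t)
    (fun t => (hh.hasDerivAt_comp_mul c t).sub ((hh.hasDerivAt t).const_mul (c ^ 3)))
    (fun t => (hh.hasDerivAt_deriv_comp_mul c t).sub ((hh.hasDerivAt_deriv t).const_mul (c ^ 3)))
    (by simp [hh.zero]) (by simp [hh.deriv_zero]) (fun t ht => by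
      have h1 := hh.concaveOn.2 (Set.mem_Ici.2 ht.le) (Set.mem_Ici.2 (le_refl (0 : ℝ))) hc
        (sub_nonneg.2 hc1) (by ring)
      simp only [smul_eq_mul, hh.deriv2_zero, mul_zero, add_zero] at h1
      have := mul_le_mul_of_nonneg_left h1 (sq_nonneg c)
      nlinarith) ht
  simpa using this

/-- The same double integration with monotonicity of `h''`: the quotient `h t / t ^ 2` is
nondecreasing. -/
theorem le_sq_mul {c t : ℝ} (hc : 0 ≤ c) (hc1 : c ≤ 1) (ht : 0 ≤ t) :
    h (c * t) ≤ c ^ 2 * h t := by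
  have := nonneg_of_deriv2_nonneg (F := fun t => c ^ 2 * h t - h (c * t))
    (fun t => ((hh.hasDerivAt t).const_mul (c ^ 2)).sub (hh.hasDerivAt_comp_mul c t))
    (fun t => ((hh.hasDerivAt_deriv t).const_mul (c ^ 2)).sub (hh.hasDerivAt_deriv_comp_mul c t))
    (by simp [hh.zero]) (by simp [hh.deriv_zero]) (fun t ht => by
      have h1 := hh.strictMonoOn.monotoneOn (Set.mem_Ici.2 (mul_nonneg hc ht.le))
        (Set.mem_Ici.2 ht.le) (mul_le_of_le_one_left ht.le hc1)
      have := mul_le_mul_of_nonneg_left h1 (sq_nonneg c)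
      nlinarith) ht
  simpa using this

theorem apply_abs (y : ℝ) : h |y| = h y := by
  rcases abs_choice y with h1 | h1 <;> rw [h1]
  exact hh.even y

theorem pos_of_pos {t : ℝ} (ht : 0 < t) : 0 < h t := by
  have h2 : ∀ t, 0 < t → 0 < deriv (deriv h) t := fun t ht => by
    have := hh.strictMonoOn (Set.mem_Ici.2 le_rfl) (Set.mem_Ici.2 ht.le) ht
    rwa [hh.deriv2_zero] at this
  have key : ∀ {G G₁ : ℝ → ℝ}, (∀ t, HasDerivAt G (G₁ t) t) → G 0 = 0 → (∀ t, 0 < t → 0 < G₁ t) →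
      ∀ t, 0 < t → 0 < G t := by
    intro G G₁ hG hG0 hG1 t ht
    have : StrictMonoOn G (Set.Ici 0) := strictMonoOn_of_deriv_pos (convex_Ici 0)
      (fun x _ => (hG x).continuousAt.continuousWithinAt) fun x hx => by
        rw [interior_Ici] at hx
        rw [(hG x).deriv]
        exact hG1 x hx
    simpa [hG0] using this (Set.mem_Ici.2 le_rfl) (Set.mem_Ici.2 ht.le) ht
  exact key hh.hasDerivAt hh.zero (key hh.hasDerivAt_deriv hh.deriv_zero h2) t ht

theorem nonneg (y : ℝ) : 0 ≤ h y := by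
  rw [← hh.apply_abs]
  rcases (abs_nonneg y).eq_or_lt with h0 | h0
  · rw [← h0, hh.zero]
  · exact (hh.pos_of_pos h0).le

theorem sq_le {y b : ℝ} (hb : 0 < b) : y ^ 2 ≤ b ^ 2 * (1 + h y * (1 / h b)) := by
  have hpos := hh.pos_of_pos hb
  have hy := hh.nonneg y
  rcases le_total |y| b with h1 | h1
  · have : y ^ 2 ≤ b ^ 2 := sq_le_sq' (by linarith [neg_abs_le y]) ((le_abs_self y).trans h1)
    have h2 : 0 ≤ b ^ 2 * (h y * (1 / h b)) := by positivity
    nlinarith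
  · have hy0 : 0 < |y| := hb.trans_le h1
    have h2 := hh.le_sq_mul (c := b / |y|) (t := |y|) (by positivity) ((div_le_one hy0).2 h1) hy0.le
    rw [div_mul_cancel₀ _ hy0.ne', hh.apply_abs, div_pow, sq_abs, div_mul_eq_mul_div,
      le_div_iff₀ (by rw [← sq_abs]; positivity)] at h2
    have h3 : y ^ 2 ≤ b ^ 2 * (h y * (1 / h b)) := by
      rw [mul_one_div, mul_div_assoc', le_div_iff₀ hpos]
      linarith
    nlinarith [sq_nonneg b]

/-- For `|y| ≤ b` this is monotonicity of `h t / t ^ 3`. The hypothesis `hy` leaves only `|y| = b`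
in the other case. This is how the hedge pays for cubic errors. -/
theorem abs_pow_three_le {y b : ℝ} (hb : 0 < b) (hy : h y * (1 / h b) ≤ 1) :
    |y| ^ 3 ≤ b ^ 3 * (h y * (1 / h b)) := by
  have hpos := hh.pos_of_pos hb
  rcases le_total |y| b with h1 | h1
  · have h2 := hh.pow_three_mul_le (c := |y| / b) (t := b) (by positivity) ((div_le_one hb).2 h1) hb.le
    rw [div_mul_cancel₀ _ hb.ne', hh.apply_abs, div_pow, div_mul_eq_mul_div,
      div_le_iff₀ (by positivity)] at h2
    rw [mul_one_div, mul_div_assoc', le_div_iff₀ hpos]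
    linarith
  · have hy0 : 0 < |y| := hb.trans_le h1
    have h2 := hh.le_sq_mul (c := b / |y|) (t := |y|) (by positivity) ((div_le_one hy0).2 h1) hy0.le
    rw [div_mul_cancel₀ _ hy0.ne', hh.apply_abs] at h2
    rw [mul_one_div, div_le_one hpos] at hy
    have h3 : 1 ≤ (b / |y|) ^ 2 := by
      by_contra h4
      push Not at h4
      nlinarith
    have h4 : |y| = b := by
      refine le_antisymm ?_ h1
      by_contra h5
      push Not at h5
      have : b / |y| < 1 := (div_lt_one hy0).2 h5
      have h6 : 0 < b / |y| := by positivity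
      nlinarith
    rw [← hh.apply_abs, h4, mul_one_div_cancel hpos.ne', mul_one]

end IsExtraHedge

/-! ### Exponential approximation of the growth factor -/

/-- The factor by which the wealth grows in one round if a Skeptic bets the fraction `lam` on `y`
and the fraction `lam ^ 2 / 2` on `y ^ 2 - v`. -/
noncomputable def factor (v lam y : ℝ) : ℝ := 1 + (lam * y + lam ^ 2 / 2 * (y ^ 2 - v))

/-- The derivative of the difference is `-(t ^ 2 / 2) / (1 + t + t ^ 2 / 2)`, which lies in `[-t ^
2, 0]` because the denominator is at least `1 / 2`. The bound thus holds for all real `t`, with no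
smallness assumption. -/
theorem abs_log_sub_le (t : ℝ) : |Real.log (1 + t + t ^ 2 / 2) - t| ≤ |t| ^ 3 / 3 := by
  have hA : ∀ t : ℝ, 1 / 2 ≤ 1 + t + t ^ 2 / 2 := fun t => by nlinarith [sq_nonneg (1 + t)]
  let φ : ℝ → ℝ := fun t => Real.log (1 + t + t ^ 2 / 2) - t
  have hφ : ∀ t, HasDerivAt φ (-(t ^ 2 / 2) / (1 + t + t ^ 2 / 2)) t := by
    intro t
    have h0 : 1 + t + t ^ 2 / 2 ≠ 0 := by linarith [hA t]
    have h1 : HasDerivAt (fun t : ℝ => 1 + t + t ^ 2 / 2) (1 + t) t := by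
      exact (((hasDerivAt_id t).const_add 1).add ((hasDerivAt_pow 2 t).div_const 2)).congr_deriv
        (by norm_num)
    refine ((h1.log h0).sub (hasDerivAt_id t)).congr_deriv ?_
    rw [div_sub_one h0]
    congr 1
    ring
  have hanti : Antitone φ := antitone_of_hasDerivAt_nonpos hφ fun t => by
    refine div_nonpos_of_nonpos_of_nonneg ?_ (by linarith [hA t])
    simp only [Left.neg_nonpos_iff]
    positivity
  have hmono : Monotone fun t => φ t + t ^ 3 / 3 := by
    refine monotone_of_hasDerivAt_nonneg
      (fun t => (hφ t).add ((hasDerivAt_pow 3 t).div_const 3)) fun t => ?_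
    have h1 : (t ^ 2 / 2) / (1 + t + t ^ 2 / 2) ≤ t ^ 2 := by
      rw [div_le_iff₀ (by linarith [hA t])]
      nlinarith [hA t, sq_nonneg t]
    simp only [neg_div]
    norm_num
    linarith
  have h0 : φ 0 = 0 := by simp [φ]
  change |φ t| ≤ _
  rcases le_total 0 t with ht | ht
  · have h1 := hanti ht
    have h2 := hmono ht
    simp only [h0] at h1 h2
    rw [abs_of_nonneg ht, abs_le]
    constructor <;> nlinarith [pow_nonneg ht 3]
  · have h1 := hanti ht
    have h2 := hmono ht
    simp only [h0] at h1 h2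
    rw [abs_of_nonpos ht, abs_le]
    constructor <;> nlinarith [pow_nonneg (neg_nonneg.2 ht) 3]

theorem abs_log_sub_add_le {t s : ℝ} (hs : 0 ≤ s) (hs' : s ≤ 1 / 4) :
    |Real.log (1 + t + t ^ 2 / 2 - s) - t + s| ≤ |t| ^ 3 / 3 + 4 * |t| * s + 8 * s ^ 2 := by
  set A := 1 + t + t ^ 2 / 2 with hAdef
  have hA : 1 / 2 ≤ A := by nlinarith [sq_nonneg (1 + t)]
  have hA0 : 0 < A := by linarith
  have h1 := abs_log_sub_le t
  rw [← hAdef] at h1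
  have hu0 : 0 ≤ s / A := by positivity
  have hu1 : s / A ≤ 2 * s := by
    rw [div_le_iff₀ hA0]; nlinarith
  have hu2 : s / A ≤ 1 / 2 := by linarith
  -- The first term is covered by the cubic bound; the second is within `2 * (s / A) ^ 2` of `-(s /
  -- A)`, since `s / A ≤ 1 / 2`.
  have hsplit : Real.log (A - s) = Real.log A + Real.log (1 - s / A) := by
    rw [← Real.log_mul hA0.ne' (by linarith)]
    congr 1
    field_simp
  have h2 : Real.log (1 - s / A) ≤ -(s / A) := by
    have := Real.log_le_sub_one_of_pos (show 0 < 1 - s / A by linarith)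
    linarith
  have h3 : -(s / A) - 2 * (s / A) ^ 2 ≤ Real.log (1 - s / A) := by
    have h4 := Real.one_sub_inv_le_log_of_pos (show 0 < 1 - s / A by linarith)
    have h5 : (1 - s / A)⁻¹ ≤ 1 + s / A + 2 * (s / A) ^ 2 := by
      rw [inv_le_iff_one_le_mul₀ (by linarith)]
      nlinarith [mul_nonneg (sq_nonneg (s / A)) (show 0 ≤ 1 - 2 * (s / A) by linarith)]
    linarith
  have h4 : |s / A - s| ≤ 4 * |t| * s := by
    have : s / A - s = s * (-(t * (1 + t / 2))) / A := by
      field_simp; rw [hAdef]; ring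
    rw [this, abs_div, abs_mul, abs_neg, abs_mul, abs_of_nonneg hs, abs_of_pos hA0,
      div_le_iff₀ hA0]
    have h5 : |1 + t / 2| ≤ 4 * A := by
      rw [abs_le]; constructor <;> nlinarith [sq_nonneg (t + 1), sq_nonneg (t + 9 / 8)]
    have := mul_le_mul_of_nonneg_left h5 (mul_nonneg hs (abs_nonneg t))
    nlinarith
  have h5 : (s / A) ^ 2 ≤ 4 * s ^ 2 := by nlinarith
  rw [hsplit]
  rw [abs_le] at h1 h4 ⊢
  constructor <;> linarith [h1.1, h1.2, h4.1, h4.2]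

theorem factor_pos {v lam : ℝ} (h1 : lam ^ 2 * v ≤ 1 / 2) (y : ℝ) : 0 < factor v lam y := by
  unfold factor
  nlinarith [sq_nonneg (1 + lam * y)]

theorem abs_log_factor_le {v lam : ℝ} (hv : 0 ≤ v) (hl : |lam| ≤ 1) (h1 : lam ^ 2 * v ≤ 1 / 2)
    (y : ℝ) : |Real.log (factor v lam y) - (lam * y - lam ^ 2 * v / 2)| ≤
      (1 + 2 * v + 2 * v ^ 2) * |lam| ^ 3 * (|y| ^ 3 + 1) := by
  have h2 := abs_log_sub_add_le (t := lam * y) (s := lam ^ 2 * v / 2) (by positivity) (by linarith)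
  have h3 : 1 + lam * y + (lam * y) ^ 2 / 2 - lam ^ 2 * v / 2 = factor v lam y := by
    unfold factor; ring
  rw [h3, sub_add] at h2
  refine h2.trans ?_
  have e : lam ^ 2 = |lam| ^ 2 := (sq_abs lam).symm
  rw [e, abs_mul]
  set l := |lam|
  set z := |y|
  have hl0 : 0 ≤ l := abs_nonneg _
  have hz0 : 0 ≤ z := abs_nonneg _
  have a1 : z ≤ z ^ 3 + 1 := by
    rcases le_total z 1 with h | h
    · nlinarith [pow_nonneg hz0 3]
    · nlinarith [mul_nonneg hz0 (show 0 ≤ z ^ 2 - 1 by nlinarith)]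
  have hl3 : 0 ≤ l ^ 3 := by positivity
  have a2 : 4 * (l * z) * (l ^ 2 * v / 2) ≤ 2 * v * l ^ 3 * (z ^ 3 + 1) := by
    have := mul_le_mul_of_nonneg_left a1 (show 0 ≤ 2 * v * l ^ 3 by positivity)
    nlinarith
  have a3 : 8 * (l ^ 2 * v / 2) ^ 2 ≤ 2 * v ^ 2 * l ^ 3 * (z ^ 3 + 1) := by
    have b1 : l ^ 4 ≤ l ^ 3 := pow_le_pow_of_le_one hl0 hl (by norm_num)
    have b2 : l ^ 3 ≤ l ^ 3 * (z ^ 3 + 1) := le_mul_of_one_le_right hl3 (by nlinarith [pow_nonneg hz0 3])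
    have := mul_le_mul_of_nonneg_left (b1.trans b2) (show 0 ≤ 2 * v ^ 2 by positivity)
    nlinarith
  have a4 : (l * z) ^ 3 / 3 ≤ l ^ 3 * (z ^ 3 + 1) := by
    have : 0 ≤ (l * z) ^ 3 := by positivity
    nlinarith
  linarith

theorem abs_log_prod_factor_le {v lam : ℝ} (hv : 0 ≤ v) (hl : |lam| ≤ 1)
    (h1 : lam ^ 2 * v ≤ 1 / 2) (y : ℕ → ℝ) (I : Finset ℕ) :
    |Real.log (∏ i ∈ I, factor v lam (y i)) -
        (lam * ∑ i ∈ I, y i - lam ^ 2 * v / 2 * #I)| ≤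
      (1 + 2 * v + 2 * v ^ 2) * |lam| ^ 3 * (∑ i ∈ I, |y i| ^ 3 + #I) := by
  rw [Real.log_prod fun i _ => (factor_pos h1 (y i)).ne']
  have h2 : ∑ i ∈ I, Real.log (factor v lam (y i)) - (lam * ∑ i ∈ I, y i - lam ^ 2 * v / 2 * #I) =
      ∑ i ∈ I, (Real.log (factor v lam (y i)) - (lam * y i - lam ^ 2 * v / 2)) := by
    simp only [sum_sub_distrib, mul_sum, sum_const, nsmul_eq_mul]
    ring
  rw [h2]
  refine (abs_sum_le_sum_abs _ _).trans
    ((sum_le_sum fun i _ => abs_log_factor_le hv hl h1 (y i)).trans (le_of_eq ?_))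
  rw [← mul_sum, sum_add_distrib]
  simp

/-! ### Forcing summability of the hedge, and control of the cubic errors -/

/-- The bound `√(n / ln ln n)` on the moves of Reality. -/
noncomputable def jumpBound (n : ℕ) : ℝ := √(n / Real.log (Real.log n))

theorem exp_one_le_log {n : ℕ} (hn : 16 ≤ n) : Real.exp 1 ≤ Real.log n := by
  have h1 : Real.log 16 ≤ Real.log n := Real.log_le_log (by norm_num) (by exact_mod_cast hn)
  have h2 : Real.log 16 = 4 * Real.log 2 := by
    rw [show (16 : ℝ) = 2 ^ 4 by norm_num, Real.log_pow]; norm_num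
  linarith [Real.exp_one_lt_d9, Real.log_two_gt_d9]

theorem one_le_log_log {n : ℕ} (hn : 16 ≤ n) : 1 ≤ Real.log (Real.log n) := by
  have := Real.log_le_log (Real.exp_pos 1) (exp_one_le_log hn)
  rwa [Real.log_exp] at this

theorem jumpBound_pos {n : ℕ} (hn : 16 ≤ n) : 0 < jumpBound n := by
  have h1 := one_le_log_log hn
  have h2 : (0 : ℝ) < n := by exact_mod_cast (by omega : 0 < n)
  unfold jumpBound
  positivity

/-- Write `ln ln n / n = (ln ln n / ln n) * (ln n / n)`; both factors decrease because `ln x / x`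
does for `x ≥ e`. The threshold 16 ensures `ln n ≥ e`. -/
theorem jumpBound_mono {n k : ℕ} (hn : 16 ≤ n) (hk : n ≤ k) : jumpBound n ≤ jumpBound k := by
  have hk16 : 16 ≤ k := hn.trans hk
  have h1 := one_le_log_log hn
  have h1' := one_le_log_log hk16
  have h2 := exp_one_le_log hn
  have h2' := exp_one_le_log hk16
  have n0 : (0 : ℝ) < n := by exact_mod_cast (by omega : 0 < n)
  have k0 : (0 : ℝ) < k := by exact_mod_cast (by omega : 0 < k)
  have e1 : Real.exp 1 ≤ n := by
    have : (16 : ℝ) ≤ n := by exact_mod_cast hn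
    linarith [Real.exp_one_lt_d9]
  have hnk : (n : ℝ) ≤ k := by exact_mod_cast hk
  have a1 : Real.log k / k ≤ Real.log n / n :=
    Real.log_div_self_antitoneOn e1 (e1.trans hnk) hnk
  have a2 : Real.log (Real.log k) / Real.log k ≤ Real.log (Real.log n) / Real.log n :=
    Real.log_div_self_antitoneOn h2 h2' (Real.log_le_log n0 hnk)
  have ln0 : 0 < Real.log n := (Real.exp_pos 1).trans_le h2
  have lk0 : 0 < Real.log k := (Real.exp_pos 1).trans_le h2'
  have a3 : Real.log (Real.log k) / k ≤ Real.log (Real.log n) / n := by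
    calc Real.log (Real.log k) / k = Real.log (Real.log k) / Real.log k * (Real.log k / k) := by
          field_simp
      _ ≤ Real.log (Real.log n) / Real.log n * (Real.log n / n) := by gcongr
      _ = _ := by field_simp
  unfold jumpBound
  refine Real.sqrt_le_sqrt ?_
  have := (inv_le_inv₀ (by positivity) (by positivity)).2 a3
  rwa [inv_div, inv_div] at this

theorem sum_abs_pow_three_le {h : ℝ → ℝ} (hh : IsExtraHedge h) {y : ℕ → ℝ} {a b N : ℕ}
    (ha : 16 ≤ a) (hbN : b ≤ N) (hy : ∀ i ∈ Ico a b, h (y i) * (1 / h (jumpBound i)) ≤ 1) :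
    ∑ i ∈ Ico a b, |y i| ^ 3 ≤
      jumpBound N ^ 3 * ∑ i ∈ Ico a b, h (y i) * (1 / h (jumpBound i)) := by
  rw [mul_sum]
  refine sum_le_sum fun i hi => ?_
  have hi' := mem_Ico.1 hi
  have h1 := jumpBound_pos (ha.trans hi'.1)
  refine (hh.abs_pow_three_le h1 (hy i hi)).trans ?_
  have := hh.nonneg (y i)
  have := hh.nonneg (jumpBound i)
  have := jumpBound_mono (ha.trans hi'.1) (hi'.2.le.trans hbN)
  gcongr

/-- Buy a small multiple of `1 / h (jumpBound n)` hedge tickets in round `n`. The total cost is at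
most the initial wealth, and bounded wealth bounds the total payoff. -/
theorem forcesLate_summable {h : ℝ → ℝ} (hh : IsExtraHedge h) {v w : ℝ} (hw : 0 ≤ w)
    (ha : Summable fun n => 1 / h (jumpBound n)) :
    ForcesLate (payoff h v w) {y | Summable fun i => h (y i) * (1 / h (jumpBound i))} := by
  intro n₀
  set a : ℕ → ℝ := fun n => 1 / h (jumpBound n) with ha_def
  have ha0 : ∀ n, 0 ≤ a n := fun n => one_div_nonneg.2 (hh.nonneg _)
  let b : ℕ → ℝ := fun n => if n < n₀ then 0 else a n
  have hb0 : ∀ n, 0 ≤ b n := fun n => by simp only [b]; split_ifs; exacts [le_rfl, ha0 n]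
  have hba : ∀ n, b n ≤ a n := fun n => by simp only [b]; split_ifs; exacts [ha0 n, le_rfl]
  let c : ℝ := 1 / (1 + w * ∑' n, a n)
  have hD : 0 < 1 + w * ∑' n, a n := by
    have : 0 ≤ ∑' n, a n := tsum_nonneg ha0
    positivity
  have hc : 0 < c := one_div_pos.2 hD
  let s : ℕ → (ℕ → ℝ) → ℝ × ℝ × ℝ := fun n _ => (0, 0, c * b n)
  have hwealth : ∀ y n, wealth (payoff h v w) s y n =
      1 - c * w * ∑ i ∈ range n, b i + c * ∑ i ∈ range n, h (y i) * b i := by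
    intro y n
    simp only [wealth, payoff_apply, s, mul_sum, sub_add, ← sum_sub_distrib]
    rw [sub_eq_add_neg, ← sum_neg_distrib]
    congr 1
    exact sum_congr rfl fun i _ => by ring
  have hcost : ∀ n, c * w * ∑ i ∈ range n, b i ≤ 1 := by
    intro n
    have h1 : ∑ i ∈ range n, b i ≤ ∑' n, a n :=
      (sum_le_sum fun i _ => hba i).trans (ha.sum_le_tsum _ fun i _ => ha0 i)
    have h2 : w * ∑ i ∈ range n, b i ≤ 1 + w * ∑' n, a n := by
      have := mul_le_mul_of_nonneg_left h1 hw
      linarith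
    rw [mul_assoc]
    calc c * (w * ∑ i ∈ range n, b i) ≤ c * (1 + w * ∑' n, a n) := by gcongr
      _ = 1 := one_div_mul_cancel hD.ne'
  have hterm : ∀ (y : ℕ → ℝ) i, 0 ≤ h (y i) * b i := fun y i => mul_nonneg (hh.nonneg _) (hb0 i)
  refine ⟨s, fun _ _ _ _ => rfl, fun n hn y => by simp [s, b, hn], fun y => ⟨fun n => ?_, ?_⟩⟩
  · rw [hwealth]
    have := mul_nonneg hc.le (sum_nonneg fun i (_ : i ∈ range n) => hterm y i)
    linarith [hcost n]
  · rintro ⟨B, hB⟩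
    have h1 : Summable fun i => h (y i) * b i := by
      refine summable_of_sum_range_le (c := B / c) (hterm y) fun n => ?_
      have := hB ⟨n, rfl⟩
      rw [hwealth] at this
      rw [le_div_iff₀' hc]
      linarith [hcost n]
    refine (summable_congr_atTop ?_).1 h1
    filter_upwards [eventually_ge_atTop n₀] with i hi
    simp only [b, if_neg (not_lt.2 hi), ha_def]

theorem abs_mul_jumpBound_pow_le {v lam : ℝ} (hv : 0 < v) {n : ℕ} (hn : 16 ≤ n)
    (hl : lam ^ 2 * (v * n) ≤ 2 * Real.log (Real.log n)) :
    |lam| ^ 3 * jumpBound n ^ 3 ≤ √(2 / v) ^ 3 := by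
  have h1 := one_le_log_log hn
  have h2 : (0 : ℝ) < n := by exact_mod_cast (by omega : 0 < n)
  rw [← mul_pow]
  have : |lam| * jumpBound n ≤ √(2 / v) := by
    refine Real.le_sqrt_of_sq_le ?_
    rw [mul_pow, sq_abs, jumpBound, Real.sq_sqrt (by positivity), mul_div_assoc',
      div_le_div_iff₀ (by positivity) hv]
    linarith
  have h0 := (jumpBound_pos hn).le
  gcongr

/-- Since `lam ^ 2 * n` is of order `ln ln n`, the square of the left-hand side is at most of order
`(ln ln n) ^ 3 / n`. -/
theorem abs_pow_three_mul_le {v lam : ℝ} (hv : 0 < v) {n : ℕ} (hn : 16 ≤ n)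
    (hn' : (2 / v) ^ 3 * (Real.log (Real.log n) ^ 3 / n) ≤ 1)
    (hl : lam ^ 2 * (v * n) ≤ 2 * Real.log (Real.log n)) : |lam| ^ 3 * n ≤ 1 := by
  have h2 : (0 : ℝ) < n := by exact_mod_cast (by omega : 0 < n)
  have h3 : lam ^ 2 * n ≤ 2 / v * Real.log (Real.log n) := by
    rw [div_mul_eq_mul_div, le_div_iff₀ hv]; linarith
  have h4 : (lam ^ 2 * n) ^ 3 ≤ (2 / v * Real.log (Real.log n)) ^ 3 := by gcongr
  have h5 : (|lam| ^ 3 * n) ^ 2 ≤ 1 := by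
    refine le_trans ?_ hn'
    rw [mul_div_assoc', ← mul_pow, le_div_iff₀ h2]
    refine le_trans (le_of_eq ?_) h4
    rw [← sq_abs lam]; ring
  have h6 : 0 ≤ |lam| ^ 3 * n := by positivity
  nlinarith

/-- The natural range of the fractions that are bet up to round `n`. -/
def AdmissibleFraction (v : ℝ) (n : ℕ) (lam : ℝ) : Prop :=
  |lam| ≤ 1 ∧ lam ^ 2 * v ≤ 1 / 2 ∧ lam ^ 2 * (v * n) ≤ 2 * Real.log (Real.log n)

theorem abs_log_prod_factor_le_of_admissible {h : ℝ → ℝ} (hh : IsExtraHedge h) {v : ℝ}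
    (hv : 0 < v) {N a b : ℕ} (ha : 16 ≤ a) (hab : a ≤ b) (hbN : b ≤ N)
    (hN : (2 / v) ^ 3 * (Real.log (Real.log N) ^ 3 / N) ≤ 1) {lam : ℝ}
    (hl : AdmissibleFraction v N lam) {y : ℕ → ℝ} {T : ℝ}
    (hy : ∀ i ∈ Ico a b, h (y i) * (1 / h (jumpBound i)) ≤ 1)
    (hT : ∑ i ∈ Ico a b, h (y i) * (1 / h (jumpBound i)) ≤ T) :
    |Real.log (∏ i ∈ Ico a b, factor v lam (y i)) -
        (lam * ∑ i ∈ Ico a b, y i - lam ^ 2 * v / 2 * (b - a : ℕ))| ≤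
      (1 + 2 * v + 2 * v ^ 2) * (√(2 / v) ^ 3 * T + 1) := by
  obtain ⟨l1, l2, l3⟩ := hl
  have h1 := abs_log_prod_factor_le hv.le l1 l2 y (Ico a b)
  rw [Nat.card_Ico] at h1
  refine h1.trans ?_
  rw [mul_assoc]
  have hN16 : 16 ≤ N := by omega
  have h2 := sum_abs_pow_three_le hh ha hbN hy
  have h3 := abs_mul_jumpBound_pow_le hv hN16 l3
  have h4 := abs_pow_three_mul_le hv hN16 hN l3
  have hs0 : 0 ≤ ∑ i ∈ Ico a b, h (y i) * (1 / h (jumpBound i)) :=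
    sum_nonneg fun i _ => mul_nonneg (hh.nonneg _) (one_div_nonneg.2 (hh.nonneg _))
  have h5 : |lam| ^ 3 * ∑ i ∈ Ico a b, |y i| ^ 3 ≤ √(2 / v) ^ 3 * T := by
    calc |lam| ^ 3 * ∑ i ∈ Ico a b, |y i| ^ 3
        ≤ |lam| ^ 3 * (jumpBound N ^ 3 * ∑ i ∈ Ico a b, h (y i) * (1 / h (jumpBound i))) := by
          gcongr
      _ = |lam| ^ 3 * jumpBound N ^ 3 * ∑ i ∈ Ico a b, h (y i) * (1 / h (jumpBound i)) := by ring
      _ ≤ √(2 / v) ^ 3 * T := by gcongr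
  have h6 : |lam| ^ 3 * ((b - a : ℕ) : ℝ) ≤ 1 := by
    refine le_trans ?_ h4
    have : ((b - a : ℕ) : ℝ) ≤ N := by exact_mod_cast (by omega : b - a ≤ N)
    gcongr
  rw [mul_add]
  gcongr

theorem eventually_log_log_pow_le (v : ℝ) :
    ∀ᶠ n : ℕ in atTop, (2 / v) ^ 3 * (Real.log (Real.log n) ^ 3 / n) ≤ 1 := by
  have := (tendsto_log_log_pow_div_natCast 3).const_mul ((2 / v) ^ 3)
  rw [mul_zero] at this
  exact this.eventually_le_const zero_lt_one

/-- The error constant is uniform in `lam`, so the fraction may be chosen depending on `n`. Rounds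
before `n₀` carry no bets, those up to `n₁`, where hedge terms may exceed 1, cost a constant, and
the rest is paid by the hedge sum. -/
theorem exists_log_prod_factor_ge {h : ℝ → ℝ} (hh : IsExtraHedge h) {v : ℝ}
    (hv : 0 < v) (n₀ : ℕ) {y : ℕ → ℝ} (hy : Summable fun i => h (y i) * (1 / h (jumpBound i))) :
    ∃ B, ∀ᶠ n : ℕ in atTop, ∀ lam, AdmissibleFraction v n lam →
      lam * ∑ i ∈ range n, y i - lam ^ 2 * (v * n) / 2 - B ≤
        Real.log (∏ i ∈ Ico n₀ n, factor v lam (y i)) := by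
  have hnn : ∀ i, 0 ≤ h (y i) * (1 / h (jumpBound i)) := fun i =>
    mul_nonneg (hh.nonneg _) (one_div_nonneg.2 (hh.nonneg _))
  obtain ⟨n₁, hn₁⟩ := eventually_atTop.1
    ((hy.tendsto_atTop_zero.eventually_le_const zero_lt_one).and (eventually_ge_atTop (max 16 n₀)))
  have h16 : 16 ≤ n₁ := (le_max_left _ _).trans (hn₁ n₁ le_rfl).2
  have h01 : n₀ ≤ n₁ := (le_max_right _ _).trans (hn₁ n₁ le_rfl).2
  set T := ∑' i, h (y i) * (1 / h (jumpBound i))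
  refine ⟨|∑ i ∈ range n₀, y i| +
    (1 + 2 * v + 2 * v ^ 2) * (∑ i ∈ Ico n₀ n₁, |y i| ^ 3 + (n₁ - n₀ : ℕ)) +
    (1 + 2 * v + 2 * v ^ 2) * (√(2 / v) ^ 3 * T + 1), ?_⟩
  filter_upwards [eventually_log_log_pow_le v, eventually_ge_atTop n₁] with n hn hn1 lam hl
  have h1 := abs_log_prod_factor_le_of_admissible hh hv h16 hn1 le_rfl hn hl (T := T)
    (fun i hi => (hn₁ i (mem_Ico.1 hi).1).1) (hy.sum_le_tsum _ fun i _ => hnn i)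
  have h2 := abs_log_prod_factor_le hv.le hl.1 hl.2.1 y (Ico n₀ n₁)
  have h3 : (1 + 2 * v + 2 * v ^ 2) * |lam| ^ 3 *
      (∑ i ∈ Ico n₀ n₁, |y i| ^ 3 + (#(Ico n₀ n₁) : ℝ)) ≤
      (1 + 2 * v + 2 * v ^ 2) * (∑ i ∈ Ico n₀ n₁, |y i| ^ 3 + (n₁ - n₀ : ℕ)) := by
    rw [Nat.card_Ico]
    have : |lam| ^ 3 ≤ 1 := pow_le_one₀ (abs_nonneg _) hl.1
    have h0 : 0 ≤ ∑ i ∈ Ico n₀ n₁, |y i| ^ 3 := sum_nonneg fun i _ => by positivity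
    have : (1 + 2 * v + 2 * v ^ 2) * |lam| ^ 3 ≤ 1 + 2 * v + 2 * v ^ 2 :=
      mul_le_of_le_one_right (by positivity) this
    gcongr
  rw [Nat.card_Ico] at h2 h3
  have hlog : Real.log (∏ i ∈ Ico n₀ n, factor v lam (y i)) =
      Real.log (∏ i ∈ Ico n₀ n₁, factor v lam (y i)) +
      Real.log (∏ i ∈ Ico n₁ n, factor v lam (y i)) := by
    rw [← prod_Ico_consecutive _ h01 hn1, Real.log_mul]
    all_goals exact (prod_pos fun i _ => factor_pos hl.2.1 _).ne'
  have hsum : ∑ i ∈ range n, y i = ∑ i ∈ range n₀, y i +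
      (∑ i ∈ Ico n₀ n₁, y i + ∑ i ∈ Ico n₁ n, y i) := by
    rw [sum_Ico_consecutive _ h01 hn1, sum_range_add_sum_Ico _ (h01.trans hn1)]
  have h4 : lam * ∑ i ∈ range n₀, y i ≤ |∑ i ∈ range n₀, y i| := by
    refine (le_abs_self _).trans ?_
    rw [abs_mul]
    exact mul_le_of_le_one_left (abs_nonneg _) hl.1
  have h5 : ((n₁ - n₀ : ℕ) : ℝ) + (n - n₁ : ℕ) ≤ n := by
    exact_mod_cast (by omega : n₁ - n₀ + (n - n₁) ≤ n)
  have h6 : lam ^ 2 * v / 2 * (n₁ - n₀ : ℕ) + lam ^ 2 * v / 2 * (n - n₁ : ℕ) ≤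
      lam ^ 2 * (v * n) / 2 := by
    rw [← mul_add]
    have := mul_le_mul_of_nonneg_left h5 (show 0 ≤ lam ^ 2 * v / 2 by positivity)
    linarith
  rw [hlog, hsum, mul_add, mul_add]
  have h7 := (abs_le.1 h1).1
  have h8 := (abs_le.1 (h2.trans h3)).1
  linarith

/-! ### The upper bound: mixing fractions in geometric progression -/

theorem one_add_payoff_factor (h : ℝ → ℝ) (v w lam y : ℝ) :
    1 + payoff h v w y (lam, lam ^ 2 / 2, 0) = factor v lam y := by
  rw [payoff_apply, factor]; ring

/-- The mixture of the strategies that bet fixed fractions in geometric progression. -/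
theorem exists_mixture_factor (h : ℝ → ℝ) {v w : ℝ} (hv : 0 ≤ v) (n₀ : ℕ) {p lam : ℕ → ℝ}
    (hp : ∀ k, 0 < p k) (hps : Summable p) (hl : ∀ k, |lam k| ≤ 1)
    (hlv : ∀ k, lam k ^ 2 * v ≤ 1 / 2) :
    ∃ t : ℕ → (ℕ → ℝ) → ℝ × ℝ × ℝ, Predictable t ∧ (∀ n < n₀, ∀ y, t n y = 0) ∧
      (∀ y n, 0 ≤ wealth (payoff h v w) t y n) ∧ ∀ y k n, n₀ ≤ n →
        p k * ∏ i ∈ Ico n₀ n, factor v (lam k) (y i) ≤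
          (∑' k, p k) * wealth (payoff h v w) t y n := by
  let r : ℕ → ℕ → (ℕ → ℝ) → ℝ × ℝ × ℝ := fun k n _ =>
    if n < n₀ then 0 else (lam k, lam k ^ 2 / 2, 0)
  have hr : ∀ k, Predictable (r k) := fun k _ _ _ _ => rfl
  have hfac : ∀ k i (y : ℕ → ℝ), 1 + payoff h v w (y i) (r k i y) =
      if i < n₀ then 1 else factor v (lam k) (y i) := by
    intro k i y
    simp only [r]
    split_ifs
    · simp
    · exact one_add_payoff_factor h v w _ _
  have hpos : ∀ k (y : ℕ → ℝ) i, 0 < 1 + payoff h v w (y i) (r k i y) := fun k y i => by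
    rw [hfac]; split_ifs; exacts [one_pos, factor_pos (hlv k) _]
  have hwp := fun k => exists_wealth_eq_prod (payoff h v w) (hr k)
  have hnn : ∀ k y n, 0 < ∏ i ∈ range n, (1 + payoff h v w (y i) (r k i y)) :=
    fun k y n => prod_pos fun i _ => hpos k y i
  have hle : ∀ k (y : ℕ → ℝ) i,
      1 + payoff h v w (y i) (r k i y) ≤ 1 + (|y i| + y i ^ 2) := by
    intro k y i
    rw [hfac]
    have hy0 := abs_nonneg (y i)
    have hy2 := sq_nonneg (y i)
    split_ifs
    · linarith
    · have h1 : lam k * y i ≤ |y i| := by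
        refine (le_abs_self _).trans ?_
        rw [abs_mul]
        exact mul_le_of_le_one_left hy0 (hl k)
      have h2 : lam k ^ 2 ≤ 1 := by
        rw [← sq_abs]; exact pow_le_one₀ (abs_nonneg _) (hl k)
      have h3 : lam k ^ 2 * y i ^ 2 ≤ y i ^ 2 := mul_le_of_le_one_left hy2 h2
      have h4 : 0 ≤ lam k ^ 2 * v := by positivity
      unfold factor
      nlinarith
  have hrn : ∀ k n y, ‖r k n y‖ ≤ 1 := by
    intro k n y
    simp only [r]
    split_ifs
    · simp
    · have h2 : lam k ^ 2 ≤ 1 := by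
        rw [← sq_abs]; exact pow_le_one₀ (abs_nonneg _) (hl k)
      simp only [Prod.norm_mk, Real.norm_eq_abs]
      rw [abs_of_nonneg (show 0 ≤ lam k ^ 2 / 2 by positivity)]
      simp only [abs_zero, max_le_iff]
      exact ⟨hl k, by linarith, by norm_num⟩
  obtain ⟨t, t1, t2, t3⟩ := exists_mixture (payoff h v w) hp hps
    (fun k n y => (∏ i ∈ range n, (1 + payoff h v w (y i) (r k i y))) • r k n y)
    (fun k => (hwp k).1) (by
      intro n y
      refine ⟨∏ i ∈ range n, (1 + (|y i| + y i ^ 2)), fun k => ?_⟩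
      rw [norm_smul, Real.norm_of_nonneg (hnn k y n).le]
      refine (mul_le_of_le_one_right (hnn k y n).le (hrn k n y)).trans ?_
      exact prod_le_prod (fun i _ => (hpos k y i).le) fun i _ => hle k y i)
  simp only [(hwp _).2] at t3
  have hZ : 0 < ∑' k, p k := hps.tsum_pos (fun k => (hp k).le) 0 (hp 0)
  have hterm : ∀ k y n, 0 ≤ p k * ∏ i ∈ range n, (1 + payoff h v w (y i) (r k i y)) :=
    fun k y n => mul_nonneg (hp k).le (hnn k y n).le
  refine ⟨t, t1, fun n hn y => t2 n y fun k => by simp [r, hn], fun y n => ?_, fun y k n hn => ?_⟩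
  · exact nonneg_of_mul_nonneg_right ((t3 y n).nonneg fun k => hterm k y n) hZ
  · refine le_trans (le_of_eq ?_) (le_hasSum (t3 y n) k fun k _ => hterm k y n)
    congr 1
    rw [← prod_range_mul_prod_Ico _ hn]
    have h1 : ∏ i ∈ range n₀, (1 + payoff h v w (y i) (r k i y)) = 1 :=
      prod_eq_one fun i hi => by rw [hfac, if_pos (mem_range.1 hi)]
    rw [h1, one_mul]
    refine prod_congr rfl fun i hi => ?_
    rw [hfac, if_neg (not_lt.2 (mem_Ico.1 hi).1)]

theorem exists_geometric_fraction {r lam₀ : ℝ} (hr0 : 0 < r) (hr1 : r < 1) (hl0 : 0 < lam₀)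
    (hl1 : lam₀ ≤ 1) {x ℓ : ℝ} (hx : 0 < x) (hx' : x ≤ lam₀) (hℓ : 1 ≤ ℓ)
    (hxℓ : Real.exp (-ℓ) ≤ x) :
    ∃ k : ℕ, r * x ≤ lam₀ * r ^ k ∧ lam₀ * r ^ k ≤ x ∧
      (k : ℝ) + 1 ≤ (1 / Real.log (1 / r) + 2) * ℓ := by
  obtain ⟨k, hk1, hk2⟩ := exists_nat_pow_near_of_lt_one (div_pos hx hl0) ((div_le_one hl0).2 hx')
    hr0 hr1
  rw [lt_div_iff₀ hl0] at hk1
  rw [div_le_iff₀ hl0] at hk2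
  -- From `lam₀ * r ^ (k + 1) < x ≤ lam₀ * r ^ k` the fraction just below `x` has index `k + 1`;
  -- hence the summand `2` in the bound on the index plus one.
  refine ⟨k + 1, ?_, by linarith, ?_⟩
  · rw [pow_succ]; nlinarith
  · have hlr : 0 < Real.log (1 / r) := Real.log_pos ((one_lt_div hr0).2 hr1)
    have h1 : Real.exp (-ℓ) ≤ r ^ k :=
      hxℓ.trans (hk2.trans (mul_le_of_le_one_right (by positivity) hl1))
    have h2 := Real.log_le_log (Real.exp_pos _) h1
    rw [Real.log_exp, Real.log_pow] at h2
    have h3 : (k : ℝ) ≤ 1 / Real.log (1 / r) * ℓ := by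
      rw [div_mul_eq_mul_div, le_div_iff₀ hlr, one_div, Real.log_inv]
      linarith
    push_cast
    nlinarith

/-- The right-hand side is the gain, in units of `ln ln n`, from betting `ρ` times the optimal
fraction when the sum exceeds the critical value by the factor `1 / r`. It increases in `ρ` on this
interval, so the worst case is `ρ = r`. -/
theorem two_sub_sq_le {r ρ : ℝ} (hr0 : 0 < r) (hr1 : r < 1) (hρr : r ≤ ρ) (hρ1 : ρ ≤ 1) :
    2 - r ^ 2 ≤ 2 * (ρ / r) - ρ ^ 2 := by
  have h1 : 2 ≤ 2 / r := by rw [le_div_iff₀ hr0]; linarith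
  have h2 : 2 * (ρ / r) - ρ ^ 2 - (2 - r ^ 2) = (ρ - r) * (2 / r - ρ - r) := by
    field_simp; ring
  have h3 := mul_nonneg (sub_nonneg.2 hρr) (show 0 ≤ 2 / r - ρ - r by linarith)
  linarith

-- The gain `(1 + δ) L` beats the logarithmic cost `(1 + δ / 2) (L + log c)` of the weight, with `δ
-- = 1 - r ^ 2`. The sign `σ` gives upper and lower bounds on the sums at once; the latter also
-- enters the lower half of the law.
set_option maxHeartbeats 1000000 in
theorem forcesLate_upper {h : ℝ → ℝ} (hh : IsExtraHedge h) {v w : ℝ} (hv : 0 < v) {σ r : ℝ}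
    (hσ : |σ| = 1) (hr0 : 0 < r) (hr1 : r < 1) :
    ForcesLate (payoff h v w) {y | (Summable fun i => h (y i) * (1 / h (jumpBound i))) →
      ∀ᶠ n : ℕ in atTop,
        σ * ∑ i ∈ range n, y i ≤ √v * √(2 * n * Real.log (Real.log n)) / r} := by
  intro n₀
  set δ := 1 - r ^ 2 with hδ
  have hδ0 : 0 < δ := by nlinarith
  set lam₀ : ℝ := 1 / (1 + v) with hlam₀
  have hl0 : 0 < lam₀ := by positivity
  have hl1 : lam₀ ≤ 1 := (div_le_one (by positivity)).2 (by linarith)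
  have hlv : lam₀ ^ 2 * v ≤ 1 / 2 := by
    rw [hlam₀, div_pow, one_pow, one_div_mul_eq_div, div_le_div_iff₀ (by positivity) (by norm_num)]
    nlinarith [sq_nonneg v]
  let lam : ℕ → ℝ := fun k => σ * (lam₀ * r ^ k)
  have hσ2 : σ ^ 2 = 1 := by rw [← sq_abs, hσ, one_pow]
  have hlam_abs : ∀ k, |lam k| = lam₀ * r ^ k := fun k => by
    simp only [lam]; rw [abs_mul, hσ, one_mul, abs_of_pos (by positivity)]
  have hlam_sq : ∀ k, lam k ^ 2 = (lam₀ * r ^ k) ^ 2 := fun k => by rw [← sq_abs, hlam_abs]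
  have hrk : ∀ k : ℕ, lam₀ * r ^ k ≤ lam₀ := fun k =>
    mul_le_of_le_one_right hl0.le (pow_le_one₀ hr0.le hr1.le)
  have hlam1 : ∀ k, |lam k| ≤ 1 := fun k => by rw [hlam_abs]; exact (hrk k).trans hl1
  have hlam2 : ∀ k, lam k ^ 2 * v ≤ 1 / 2 := fun k => by
    rw [hlam_sq]
    have := hrk k
    refine le_trans ?_ hlv
    gcongr
  let p : ℕ → ℝ := fun k => 1 / ((k : ℝ) + 1) ^ (1 + δ / 2)
  have hp : ∀ k, 0 < p k := fun k => by simp only [p]; positivity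
  have hps : Summable p := by
    have := (summable_nat_add_iff 1).2
      (Real.summable_one_div_nat_rpow.2 (show 1 < 1 + δ / 2 by linarith))
    simpa only [Nat.cast_add, Nat.cast_one] using this
  obtain ⟨t, t1, t2, t3, t4⟩ := exists_mixture_factor h (w := w) hv.le n₀ hp hps hlam1 hlam2
  refine ⟨t, t1, t2, fun y => ⟨t3 y, ?_⟩⟩
  rintro ⟨M, hM⟩ hy
  obtain ⟨B, hB⟩ := exists_log_prod_factor_ge hh hv n₀ hy
  set Z := ∑' k, p k
  have hZ : 0 < Z := hps.tsum_pos (fun k => (hp k).le) 0 (hp 0)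
  set c := 1 / Real.log (1 / r) + 2 with hc
  have hc0 : 0 < c := by
    have : 0 < Real.log (1 / r) := Real.log_pos ((one_lt_div hr0).2 hr1)
    positivity
  have hlarge : ∀ᶠ n : ℕ in atTop, B + (1 + δ / 2) * Real.log c + Z * M <
      δ / 2 * Real.log (Real.log n) :=
    (tendsto_log_log_natCast_atTop.const_mul_atTop (half_pos hδ0)).eventually_gt_atTop _
  have hsmall : ∀ᶠ n : ℕ in atTop, 2 / v * (Real.log (Real.log n) ^ 1 / n) < lam₀ ^ 2 := by
    have := (tendsto_log_log_pow_div_natCast 1).const_mul (2 / v)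
    rw [mul_zero] at this
    exact this.eventually_lt_const (by positivity)
  have hvn : ∀ᶠ n : ℕ in atTop, v ≤ n := tendsto_natCast_atTop_atTop.eventually_ge_atTop v
  filter_upwards [hB, hlarge, hsmall, hvn, eventually_ge_atTop 16, eventually_ge_atTop n₀]
    with n hBn hln hsn hvn h16 hn₀
  by_contra hS
  push Not at hS
  have hn0 : (0 : ℝ) < n := by exact_mod_cast (by omega : 0 < n)
  set L := Real.log (Real.log n) with hL
  have hL1 : 1 ≤ L := one_le_log_log h16
  have hlog : Real.exp 1 ≤ Real.log n := exp_one_le_log h16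
  have hlog0 : 0 < Real.log n := (Real.exp_pos 1).trans_le hlog
  have hlog1 : 1 ≤ Real.log n := by linarith [Real.exp_one_gt_d9]
  -- The maximiser of `lam * S - lam ^ 2 * v * n / 2` at the critical sum `S = √v * √(2 n L)`.
  set x := √(2 * L / (v * n)) with hx
  have hx2 : x ^ 2 = 2 * L / (v * n) := Real.sq_sqrt (by positivity)
  have hx0 : 0 < x := by positivity
  have hxl : x ≤ lam₀ := by
    refine Real.sqrt_le_iff.2 ⟨hl0.le, le_trans (le_of_eq ?_) hsn.le⟩
    rw [pow_one]; field_simp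
  have hxn : Real.exp (-Real.log n) ≤ x := by
    rw [Real.exp_neg, Real.exp_log hn0]
    refine Real.le_sqrt_of_sq_le ?_
    rw [inv_pow, inv_eq_one_div, div_le_div_iff₀ (by positivity) (by positivity)]
    nlinarith
  obtain ⟨k, k1, k2, k3⟩ := exists_geometric_fraction hr0 hr1 hl0 hl1 hx0 hxl hlog1 hxn
  set q := lam₀ * r ^ k with hq
  have hq0 : 0 < q := by positivity
  have hx2' : x ^ 2 * (v * n) = 2 * L := by rw [hx2]; field_simp
  have hadm : AdmissibleFraction v n (lam k) := by
    refine ⟨hlam1 k, hlam2 k, ?_⟩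
    rw [hlam_sq, ← hq, ← hL, ← hx2']
    gcongr
  have h1 := hBn _ hadm
  have h2 := t4 y k n hn₀
  have h3 := hM ⟨n, rfl⟩
  have hQ : 0 < ∏ i ∈ Ico n₀ n, factor v (lam k) (y i) :=
    prod_pos fun i _ => factor_pos (hlam2 k) _
  have h4 : lam k * ∑ i ∈ range n, y i = q * (σ * ∑ i ∈ range n, y i) := by
    simp only [lam, ← hq]; ring
  have hφ : x * (√v * √(2 * n * L)) = 2 * L := by
    rw [hx, ← Real.sqrt_mul hv.le, ← Real.sqrt_mul (by positivity),
      Real.sqrt_eq_iff_mul_self_eq (by positivity) (by positivity)]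
    field_simp
  have hgain : (1 + δ) * L ≤ lam k * ∑ i ∈ range n, y i - lam k ^ 2 * (v * n) / 2 := by
    rw [h4, hlam_sq, ← hq]
    obtain ⟨ρ, hρ⟩ : ∃ ρ, q = ρ * x := ⟨q / x, by field_simp⟩
    have hρr : r ≤ ρ := by rw [hρ] at k1; exact le_of_mul_le_mul_right k1 hx0
    have hρ1 : ρ ≤ 1 := by
      rw [hρ] at k2; exact le_of_mul_le_mul_right (by linarith) hx0
    have e1 : q * (√v * √(2 * n * L) / r) ≤ q * (σ * ∑ i ∈ range n, y i) := by gcongr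
    have e2 : q * (√v * √(2 * n * L) / r) = ρ / r * (2 * L) := by rw [hρ, ← hφ]; ring
    have e3 : q ^ 2 * (v * n) / 2 = ρ ^ 2 * L := by rw [hρ, mul_pow, mul_assoc, hx2']; ring
    have e4 := mul_le_mul_of_nonneg_right (two_sub_sq_le hr0 hr1 hρr hρ1)
      (zero_le_one.trans hL1)
    rw [e3, hδ]
    linarith
  have hpk : Real.exp (-((1 + δ / 2) * (Real.log c + L))) ≤ p k := by
    have hk0 : (0 : ℝ) < (k : ℝ) + 1 := by positivity
    simp only [p]
    rw [one_div, ← Real.rpow_neg hk0.le, Real.rpow_def_of_pos hk0]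
    refine Real.exp_le_exp.2 ?_
    have := Real.log_le_log hk0 k3
    rw [Real.log_mul hc0.ne' hlog0.ne', ← hL] at this
    have := mul_le_mul_of_nonneg_left this (show 0 ≤ 1 + δ / 2 by linarith)
    linarith
  have hfin : Z * M < p k * ∏ i ∈ Ico n₀ n, factor v (lam k) (y i) := by
    rw [← Real.exp_log hQ]
    calc Z * M < Z * M + 1 := by linarith
      _ ≤ Real.exp (Z * M) := Real.add_one_le_exp _
      _ ≤ Real.exp (-((1 + δ / 2) * (Real.log c + L)) +
          Real.log (∏ i ∈ Ico n₀ n, factor v (lam k) (y i))) := by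
          refine Real.exp_le_exp.2 ?_
          linarith
      _ = _ := Real.exp_add _ _
      _ ≤ _ := by gcongr
  have := mul_le_mul_of_nonneg_left h3 hZ.le
  linarith

/-! ### The lower bound: the betting strategy in one block -/

/-- The fraction that is optimal for the typical maximum of the sum of `N` moves. -/
noncomputable def optFraction (v : ℝ) (N : ℕ) : ℝ := √(2 * Real.log (Real.log N) / (v * N))

/-- Wealth at time `n` of a bettor who bets the fixed fraction `lam` from time `A` on. -/
noncomputable def fixedWealth (v lam : ℝ) (A n : ℕ) (y : ℕ → ℝ) : ℝ :=
  ∏ i ∈ Ico A n, factor v lam (y i)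

/-- The bets for the fixed fraction `lam`, per unit of wealth. -/
noncomputable def fixedBet (lam : ℝ) : ℝ × ℝ × ℝ := (lam, lam ^ 2 / 2, 0)

/-- The accumulated hedge at time `n` since time `A`. -/
noncomputable def hedgeSum (h : ℝ → ℝ) (A n : ℕ) (y : ℕ → ℝ) : ℝ :=
  ∑ i ∈ Ico A n, h (y i) * (1 / h (jumpBound i))

/-- The weight of the short position in `blockBet`. -/
noncomputable def blockWeight (d : ℝ) (N : ℕ) : ℝ := Real.exp (-((1 - d) * Real.log (Real.log N)))

/-- The weight of the outer fractions relative to the middle one in `blockBet`. -/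
noncomputable def sideWeight (d : ℝ) (N : ℕ) : ℝ := Real.exp (-(d ^ 2 * Real.log (Real.log N)))

theorem sideWeight_pos (d : ℝ) (N : ℕ) : 0 < sideWeight d N := Real.exp_pos _

theorem blockWeight_pos (d : ℝ) (N : ℕ) : 0 < blockWeight d N := Real.exp_pos _

/-- The bets in the block of rounds `A, …, N - 1` that gain if the sum of the moves in the block is
not large: short in the fraction `1 - 2 * d` of the optimal one, long in `1 - d` and `1 - 3 * d`,
and long in the hedge. The betting stops when the accumulated hedge exceeds `1`. -/
noncomputable def blockBet (h : ℝ → ℝ) (v d : ℝ) (A N n : ℕ) (y : ℕ → ℝ) : ℝ × ℝ × ℝ :=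
  let q := optFraction v N
  let p := blockWeight d N
  let ε := sideWeight d N
  if hedgeSum h A n y ≤ 1 then
    (-(p * fixedWealth v ((1 - 2 * d) * q) A n y)) • fixedBet ((1 - 2 * d) * q) +
    (p * ε * fixedWealth v ((1 - d) * q) A n y) • fixedBet ((1 - d) * q) +
    (p * ε * fixedWealth v ((1 - 3 * d) * q) A n y) • fixedBet ((1 - 3 * d) * q) +
    (0, 0, 1 / h (jumpBound n))
  else 0

theorem payoff_fixedBet (h : ℝ → ℝ) (v w lam y : ℝ) :
    payoff h v w y (fixedBet lam) = factor v lam y - 1 := by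
  rw [← one_add_payoff_factor h v w, fixedBet]; ring

theorem fixedWealth_succ (v lam : ℝ) {A n : ℕ} (hn : A ≤ n) (y : ℕ → ℝ) :
    fixedWealth v lam A (n + 1) y = fixedWealth v lam A n y * factor v lam (y n) :=
  prod_Ico_succ_top hn _

theorem fixedWealth_self (v lam : ℝ) (A : ℕ) (y : ℕ → ℝ) : fixedWealth v lam A A y = 1 := by
  simp [fixedWealth]

theorem hedgeSum_succ (h : ℝ → ℝ) {A n : ℕ} (hn : A ≤ n) (y : ℕ → ℝ) :
    hedgeSum h A (n + 1) y = hedgeSum h A n y + h (y n) * (1 / h (jumpBound n)) :=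
  sum_Ico_succ_top hn _

theorem IsExtraHedge.hedge_nonneg {h : ℝ → ℝ} (hh : IsExtraHedge h) (x : ℝ) (i : ℕ) :
    0 ≤ h x * (1 / h (jumpBound i)) :=
  mul_nonneg (hh.nonneg _) (one_div_nonneg.2 (hh.nonneg _))

theorem hedgeSum_mono {h : ℝ → ℝ} (hh : IsExtraHedge h) (A : ℕ) (y : ℕ → ℝ) {i n : ℕ} (hi : i ≤ n) :
    hedgeSum h A i y ≤ hedgeSum h A n y :=
  sum_le_sum_of_subset_of_nonneg (Ico_subset_Ico_right hi) fun _ _ _ => hh.hedge_nonneg _ _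

/-- The wealth in a block before the betting stops. -/
theorem blockWealth_eq {h : ℝ → ℝ} (v w d : ℝ) (A N : ℕ) {n : ℕ} (hn : A ≤ n) (y : ℕ → ℝ)
    (halive : ∀ i ∈ Ico A n, hedgeSum h A i y ≤ 1) :
    1 + ∑ i ∈ Ico A n, payoff h v w (y i) (blockBet h v d A N i y) =
      1 + blockWeight d N * (1 - 2 * sideWeight d N) -
      blockWeight d N * (fixedWealth v ((1 - 2 * d) * optFraction v N) A n y -
        sideWeight d N * fixedWealth v ((1 - d) * optFraction v N) A n y -
        sideWeight d N * fixedWealth v ((1 - 3 * d) * optFraction v N) A n y) +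
      hedgeSum h A n y - w * ∑ i ∈ Ico A n, 1 / h (jumpBound i) := by
  induction n, hn using Nat.le_induction with
  | base => simp [fixedWealth_self, hedgeSum]; ring
  | succ n hn ih =>
    have h1 := ih fun i hi => halive i (by rw [mem_Ico] at hi ⊢; omega)
    have h2 := halive n (by simp [hn])
    rw [sum_Ico_succ_top hn, ← add_assoc, h1, blockBet, if_pos h2, sum_Ico_succ_top hn,
      fixedWealth_succ _ _ hn, fixedWealth_succ _ _ hn, fixedWealth_succ _ _ hn,
      hedgeSum_succ h hn]
    simp only [map_add, map_smul, smul_eq_mul, payoff_fixedBet]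
    rw [payoff_apply]
    ring

/-- A bound for the errors of the exponential approximation in a block. -/
noncomputable def blockError (v : ℝ) : ℝ := (1 + 2 * v + 2 * v ^ 2) * (√(2 / v) ^ 3 * 1 + 1)

theorem blockError_nonneg {v : ℝ} (hv : 0 < v) : 0 ≤ blockError v := by
  unfold blockError; positivity

/-- The requirements on a block for `blockBet` to work. -/
structure GoodBlock (h : ℝ → ℝ) (v w d : ℝ) (A N : ℕ) : Prop where
  start : 16 ≤ A
  start_le : A ≤ d * N
  le : A ≤ N
  log_log_pow : (2 / v) ^ 3 * (Real.log (Real.log N) ^ 3 / N) ≤ 1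
  fraction_le : optFraction v N ≤ 1
  fraction_sq_le : optFraction v N ^ 2 * v ≤ 1 / 2
  cost : w * ∑ i ∈ Ico A N, 1 / h (jumpBound i) ≤ 1 / 4
  side : sideWeight d N ≤ 1 / 4
  error : blockError v ≤ d ^ 2 * Real.log (Real.log N)
  short : Real.exp ((2 * blockError v + 2) / d + blockError v - d * Real.log (Real.log N)) *
    (2 + 2 / v) ≤ 1 / 4

namespace GoodBlock

variable {h : ℝ → ℝ} {v w d : ℝ} {A N : ℕ}

theorem one_le_log_log (hb : GoodBlock h v w d A N) : 1 ≤ Real.log (Real.log N) :=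
  LILGame.one_le_log_log (hb.start.trans hb.le)

theorem natCast_pos (hb : GoodBlock h v w d A N) : (0 : ℝ) < N := by
  have := hb.start.trans hb.le
  exact_mod_cast (by omega : 0 < N)

theorem optFraction_sq (hb : GoodBlock h v w d A N) (hv : 0 < v) :
    optFraction v N ^ 2 * (v * N) = 2 * Real.log (Real.log N) := by
  have := hb.natCast_pos
  have := hb.one_le_log_log
  rw [optFraction, Real.sq_sqrt (by positivity)]
  field_simp

theorem admissible (hb : GoodBlock h v w d A N) (hv : 0 < v) {c : ℝ} (hc : |c| ≤ 1) :
    AdmissibleFraction v N (c * optFraction v N) := by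
  have h0 : 0 ≤ optFraction v N := Real.sqrt_nonneg _
  have h1 : c ^ 2 ≤ 1 := by rw [← sq_abs]; exact pow_le_one₀ (abs_nonneg _) hc
  have h2 := hb.optFraction_sq hv
  have h3 := hb.natCast_pos
  have key : (c * optFraction v N) ^ 2 ≤ optFraction v N ^ 2 := by
    rw [mul_pow]; exact mul_le_of_le_one_left (sq_nonneg _) h1
  refine ⟨?_, ?_, ?_⟩
  · rw [abs_mul, abs_of_nonneg h0]
    exact mul_le_one₀ hc h0 hb.fraction_le
  · exact (mul_le_mul_of_nonneg_right key hv.le).trans hb.fraction_sq_le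
  · rw [← h2]; gcongr

theorem factor_pos (hb : GoodBlock h v w d A N) (hv : 0 < v) {c : ℝ} (hc : |c| ≤ 1) (x : ℝ) :
    0 < factor v (c * optFraction v N) x :=
  LILGame.factor_pos (hb.admissible hv hc).2.1 x

theorem fixedWealth_pos (hb : GoodBlock h v w d A N) (hv : 0 < v) {c : ℝ} (hc : |c| ≤ 1)
    (n : ℕ) (y : ℕ → ℝ) : 0 < fixedWealth v (c * optFraction v N) A n y :=
  prod_pos fun _ _ => hb.factor_pos hv hc _

theorem abs_log_fixedWealth_le (hb : GoodBlock h v w d A N) (hh : IsExtraHedge h) (hv : 0 < v)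
    {c : ℝ} (hc : |c| ≤ 1) {n : ℕ} (hn : A ≤ n) (hnN : n ≤ N) {y : ℕ → ℝ}
    (hy : hedgeSum h A n y ≤ 1) :
    |Real.log (fixedWealth v (c * optFraction v N) A n y) -
      (c * (optFraction v N * ∑ i ∈ Ico A n, y i) -
        c ^ 2 * (optFraction v N ^ 2 * v / 2 * (n - A : ℕ)))| ≤ blockError v := by
  have := abs_log_prod_factor_le_of_admissible hh hv hb.start hn hnN hb.log_log_pow
    (hb.admissible hv hc) (y := y) (T := 1) (fun i hi => (single_le_sum
      (f := fun i => h (y i) * (1 / h (jumpBound i)))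
      (fun i _ => hh.hedge_nonneg _ _) hi).trans hy) hy
  unfold fixedWealth blockError
  convert this using 3
  ring

theorem time_le (hb : GoodBlock h v w d A N) (hv : 0 < v) {n : ℕ} (hnN : n ≤ N) :
    optFraction v N ^ 2 * v / 2 * (n - A : ℕ) ≤ Real.log (Real.log N) := by
  have h2 := hb.optFraction_sq hv
  have h3 : ((n - A : ℕ) : ℝ) ≤ N := by exact_mod_cast (by omega : n - A ≤ N)
  have := mul_le_mul_of_nonneg_left h3 (show 0 ≤ optFraction v N ^ 2 * v / 2 by positivity)
  linarith

theorem log_six_le : Real.log 6 ≤ 2 := by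
  rw [Real.log_le_iff_le_exp (by norm_num), show (2 : ℝ) = 1 + 1 by norm_num, Real.exp_add]
  have := Real.exp_one_gt_d9
  nlinarith

/-- The middle fraction cannot be far ahead unless the upper fraction compensates for it. -/
theorem weight_mul_fixedWealth_le (hb : GoodBlock h v w d A N) (hh : IsExtraHedge h) (hv : 0 < v)
    (hd : 0 < d) (hd' : d ≤ 1 / 8) {n : ℕ} (hn : A ≤ n) (hnN : n ≤ N) {y : ℕ → ℝ}
    (hy : hedgeSum h A n y ≤ 1)
    (hc : sideWeight d N * fixedWealth v ((1 - d) * optFraction v N) A n y ≤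
      6 * fixedWealth v ((1 - 2 * d) * optFraction v N) A n y) :
    blockWeight d N * fixedWealth v ((1 - 2 * d) * optFraction v N) A n y ≤
      Real.exp ((2 * blockError v + 2) / d + blockError v - d * Real.log (Real.log N)) := by
  have c1 : |1 - d| ≤ 1 := by rw [abs_le]; constructor <;> linarith
  have c2 : |1 - 2 * d| ≤ 1 := by rw [abs_le]; constructor <;> linarith
  have e1 := (abs_le.1 (hb.abs_log_fixedWealth_le hh hv c1 hn hnN hy)).1
  have e2 := (abs_le.1 (hb.abs_log_fixedWealth_le hh hv c2 hn hnN hy)).2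
  have p1 := hb.fixedWealth_pos hv c1 n y
  have p2 := hb.fixedWealth_pos hv c2 n y
  have hτ := hb.time_le hv hnN
  have h1 := Real.log_le_log (mul_pos (sideWeight_pos d N) p1) hc
  rw [Real.log_mul (sideWeight_pos d N).ne' p1.ne', Real.log_mul (by norm_num) p2.ne', sideWeight,
    Real.log_exp] at h1
  have h6 := log_six_le
  rw [← Real.exp_log p2, blockWeight, ← Real.exp_add]
  refine Real.exp_le_exp.2 ?_
  set L := Real.log (Real.log N)
  set B := blockError v
  set u := optFraction v N * ∑ i ∈ Ico A n, y i
  set τ := optFraction v N ^ 2 * v / 2 * (n - A : ℕ)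
  have hB := blockError_nonneg hv
  -- Comparing exponents `c * u - c ^ 2 * τ` for `c = 1 - d` and `c = 1 - 2 * d` bounds `u`. With `τ
  -- ≤ L` the middle exponent is then at most `(1 - 2 * d) * L` up to constants, which the weight
  -- `exp (-(1 - d) * L)` turns into `exp (-d * L)`.
  have h2 : d * u ≤ (2 * (1 - 2 * d) * d + d ^ 2) * τ + d ^ 2 * L + 2 * B + 2 := by linarith
  have h3 : u ≤ (2 * (1 - 2 * d) + d) * τ + d * L + (2 * B + 2) / d := by
    refine le_of_mul_le_mul_left (h2.trans (le_of_eq ?_)) hd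
    field_simp
    ring
  have h4 := mul_le_mul_of_nonneg_left h3 (show 0 ≤ 1 - 2 * d by linarith)
  have h5 : (1 - 2 * d) * ((2 * B + 2) / d) ≤ (2 * B + 2) / d :=
    mul_le_of_le_one_left (by positivity) (by linarith)
  have h7 : (1 - 2 * d) * (1 - d) * τ ≤ (1 - 2 * d) * (1 - d) * L :=
    mul_le_mul_of_nonneg_left hτ (mul_nonneg (by linarith) (by linarith))
  nlinarith

/-- Ensures that a larger fraction which covers a smaller one with a reserve factor 6 still covers
it after one more round, whatever the move. -/
theorem factor_le_six_mul_factor {a c q x : ℝ} (ha : 0 < a) (hac : a ≤ c)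
    (hcv : (c * q) ^ 2 * v ≤ 1 / 2) (hv : 0 < v) :
    factor v (a * q) x ≤ 6 * factor v (c * q) x := by
  obtain ⟨b, hb⟩ : ∃ b, b = a / c := ⟨_, rfl⟩
  have hc : 0 < c := ha.trans_le hac
  have hb0 : 0 < b := by rw [hb]; positivity
  have hb1 : b ≤ 1 := by rw [hb]; exact (div_le_one hc).2 hac
  have hbc : a = b * c := by rw [hb]; field_simp
  have h1 : a * q * x = b * (c * q * x) := by rw [hbc]; ring
  set t := c * q * x with ht
  have h2 : factor v (c * q) x = 1 + t + t ^ 2 / 2 - (c * q) ^ 2 * v / 2 := by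
    unfold factor; rw [ht]; ring
  have h3 : factor v (a * q) x = 1 + b * t + (b * t) ^ 2 / 2 - (a * q) ^ 2 * v / 2 := by
    unfold factor; rw [← h1]; ring
  have h4 : 0 ≤ (a * q) ^ 2 * v := by positivity
  have h5 : (1 + b * t) ^ 2 ≤ 2 * (1 + t) ^ 2 + 2 := by
    have e : 1 + b * t = b * (1 + t) + (1 - b) := by ring
    rw [e]
    have e1 : (b * (1 + t)) ^ 2 ≤ (1 + t) ^ 2 := by
      rw [mul_pow]; exact mul_le_of_le_one_left (sq_nonneg _) (pow_le_one₀ hb0.le hb1)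
    nlinarith [sq_nonneg (b * (1 + t) - (1 - b))]
  rw [h2, h3]
  nlinarith [sq_nonneg (1 + t)]

/-- A jump may be arbitrarily large, but its quadratic effect is at most linear in the hedge payoff
of the same round, because `h t / t ^ 2` is nondecreasing. -/
theorem factor_le (hb : GoodBlock h v w d A N) (hh : IsExtraHedge h) (hv : 0 < v) {c : ℝ}
    (hc : |c| ≤ 1) {n : ℕ} (hn : A ≤ n) (hnN : n ≤ N) (x : ℝ) :
    factor v (c * optFraction v N) x ≤ 2 + 2 / v * (1 + h x * (1 / h (jumpBound n))) := by
  have h16 : 16 ≤ n := hb.start.trans hn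
  have hL := hb.one_le_log_log
  have hN := hb.natCast_pos
  set t := c * optFraction v N * x with ht
  have h1 : factor v (c * optFraction v N) x =
      1 + t + t ^ 2 / 2 - (c * optFraction v N) ^ 2 * v / 2 := by
    unfold factor; rw [ht]; ring
  have h2 : 0 ≤ (c * optFraction v N) ^ 2 * v := by positivity
  have h3 : t ^ 2 ≤ 2 / v * (1 + h x * (1 / h (jumpBound n))) := by
    have e1 := hh.sq_le (y := x) (jumpBound_pos h16)
    have e2 : c ^ 2 ≤ 1 := by rw [← sq_abs]; exact pow_le_one₀ (abs_nonneg _) hc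
    have e3 : optFraction v N ^ 2 * jumpBound n ^ 2 ≤ 2 / v := by
      have f1 := jumpBound_mono h16 hnN
      have f2 := (jumpBound_pos h16).le
      calc optFraction v N ^ 2 * jumpBound n ^ 2 ≤ optFraction v N ^ 2 * jumpBound N ^ 2 := by
            gcongr
        _ = 2 / v := by
          rw [optFraction, jumpBound, Real.sq_sqrt (by positivity), Real.sq_sqrt (by positivity)]
          field_simp
    have e4 := hh.hedge_nonneg x n
    calc t ^ 2 = c ^ 2 * (optFraction v N ^ 2 * x ^ 2) := by rw [ht]; ring
      _ ≤ 1 * (optFraction v N ^ 2 * x ^ 2) := by gcongr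
      _ ≤ optFraction v N ^ 2 *
          (jumpBound n ^ 2 * (1 + h x * (1 / h (jumpBound n)))) := by rw [one_mul]; gcongr
      _ = optFraction v N ^ 2 * jumpBound n ^ 2 * (1 + h x * (1 / h (jumpBound n))) := by ring
      _ ≤ _ := by gcongr
  rw [h1]
  nlinarith [sq_nonneg (t - 1)]

/-- The wealth in a block stays away from zero. -/
theorem half_le_blockWealth (hb : GoodBlock h v w d A N) (hh : IsExtraHedge h) (hv : 0 < v)
    (hw : 0 ≤ w) (hd : 0 < d) (hd' : d ≤ 1 / 8) {n : ℕ} (hn : A ≤ n) (hnN : n ≤ N) (y : ℕ → ℝ) :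
    1 / 2 ≤ 1 + ∑ i ∈ Ico A n, payoff h v w (y i) (blockBet h v d A N i y) := by
  induction n, hn using Nat.le_induction with
  | base => norm_num
  | succ n hn ih =>
    have ih := ih (by omega)
    by_cases halive : hedgeSum h A n y ≤ 1
    swap
    · rw [sum_Ico_succ_top hn, ← add_assoc, blockBet, if_neg halive]
      simpa using ih
    rw [blockWealth_eq v w d A N (hn.trans n.le_succ) y fun i hi =>
      (hedgeSum_mono hh A y (Nat.le_of_lt_succ (mem_Ico.1 hi).2)).trans halive]
    have c1 : |1 - d| ≤ 1 := by rw [abs_le]; constructor <;> linarith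
    have c2 : |1 - 2 * d| ≤ 1 := by rw [abs_le]; constructor <;> linarith
    have c3 : |1 - 3 * d| ≤ 1 := by rw [abs_le]; constructor <;> linarith
    have hp := blockWeight_pos d N
    have hε := sideWeight_pos d N
    have hε' := hb.side
    have q3 := hb.fixedWealth_pos hv c3 (n + 1) y
    have q1 := hb.fixedWealth_pos hv c1 n y
    have q2 := hb.fixedWealth_pos hv c2 n y
    have f2 := hb.factor_pos hv c2 (y n)
    have f1 := hb.factor_pos hv c1 (y n)
    have hle := hb.factor_le hh hv c2 hn (by omega) (y n)
    have hhn := hh.hedge_nonneg (y n) n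
    have hcost : w * ∑ i ∈ Ico A (n + 1), 1 / h (jumpBound i) ≤ 1 / 4 := by
      refine le_trans (mul_le_mul_of_nonneg_left ?_ hw) hb.cost
      exact sum_le_sum_of_subset_of_nonneg (Ico_subset_Ico_right hnN)
        fun _ _ _ => one_div_nonneg.2 (hh.nonneg _)
    have hH : h (y n) * (1 / h (jumpBound n)) ≤ hedgeSum h A (n + 1) y := by
      rw [hedgeSum_succ h hn]
      exact le_add_of_nonneg_left (sum_nonneg fun _ _ => hh.hedge_nonneg _ _)
    have hshort := hb.short
    set η := Real.exp ((2 * blockError v + 2) / d + blockError v - d * Real.log (Real.log N))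
    have hη : 0 < η := Real.exp_pos _
    have key : blockWeight d N * (fixedWealth v ((1 - 2 * d) * optFraction v N) A (n + 1) y -
        sideWeight d N * fixedWealth v ((1 - d) * optFraction v N) A (n + 1) y) ≤
        η * (2 + 2 / v * (1 + h (y n) * (1 / h (jumpBound n)))) := by
      rw [fixedWealth_succ _ _ hn, fixedWealth_succ _ _ hn]
      -- Without the reserve factor 6 the short position is still tiny, and the hedge absorbs the
      -- next jump; with it, the upper fraction covers the short position after the jump.
      by_cases hcomp : sideWeight d N * fixedWealth v ((1 - d) * optFraction v N) A n y ≤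
          6 * fixedWealth v ((1 - 2 * d) * optFraction v N) A n y
      · have e1 := hb.weight_mul_fixedWealth_le hh hv hd hd' hn (by omega) halive hcomp
        have e2 := mul_le_mul e1 hle f2.le hη.le
        have e3 : 0 ≤ blockWeight d N * (sideWeight d N *
          (fixedWealth v ((1 - d) * optFraction v N) A n y *
            factor v ((1 - d) * optFraction v N) (y n))) := by positivity
        linarith
      · push Not at hcomp
        have e1 : factor v ((1 - 2 * d) * optFraction v N) (y n) ≤
            6 * factor v ((1 - d) * optFraction v N) (y n) :=
          factor_le_six_mul_factor (by linarith) (by linarith) (hb.admissible hv c1).2.1 hv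
        have e2 := mul_le_mul_of_nonneg_left e1 q2.le
        have e3 := mul_le_mul_of_nonneg_right hcomp.le f1.le
        have e4 : blockWeight d N * (fixedWealth v ((1 - 2 * d) * optFraction v N) A n y *
              factor v ((1 - 2 * d) * optFraction v N) (y n) -
            sideWeight d N * (fixedWealth v ((1 - d) * optFraction v N) A n y *
              factor v ((1 - d) * optFraction v N) (y n))) ≤ 0 :=
          mul_nonpos_of_nonneg_of_nonpos hp.le (by linarith)
        exact e4.trans (by positivity)
    have k1 : 0 ≤ blockWeight d N * (1 - 2 * sideWeight d N) := mul_nonneg hp.le (by linarith)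
    have k2 : 0 ≤ blockWeight d N *
        (sideWeight d N * fixedWealth v ((1 - 3 * d) * optFraction v N) A (n + 1) y) := by
      positivity
    have k3 : η * (2 / v) ≤ 1 := by linarith
    have k4 := mul_le_mul_of_nonneg_right k3 hhn
    nlinarith

/-- The wealth at the end of a block in which the sum of the moves is not large. -/
theorem le_blockWealth_end (hb : GoodBlock h v w d A N) (hh : IsExtraHedge h) (hv : 0 < v)
    (hd : 0 < d) (hd' : d ≤ 1 / 8) {y : ℕ → ℝ} (hy : hedgeSum h A N y ≤ 1)
    (hS : ∑ i ∈ Ico A N, y i ≤ (1 - 5 * d) * (√v * √(2 * N * Real.log (Real.log N)))) :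
    1 + blockWeight d N / 2 - w * ∑ i ∈ Ico A N, 1 / h (jumpBound i) ≤
      1 + ∑ i ∈ Ico A N, payoff h v w (y i) (blockBet h v d A N i y) := by
  rw [blockWealth_eq v w d A N hb.le y fun i hi =>
      (hedgeSum_mono hh A y (mem_Ico.1 hi).2.le).trans hy]
  have c1 : |1 - d| ≤ 1 := by rw [abs_le]; constructor <;> linarith
  have c2 : |1 - 2 * d| ≤ 1 := by rw [abs_le]; constructor <;> linarith
  have c3 : |1 - 3 * d| ≤ 1 := by rw [abs_le]; constructor <;> linarith
  have e3 := (abs_le.1 (hb.abs_log_fixedWealth_le hh hv c3 hb.le le_rfl hy)).1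
  have e2 := (abs_le.1 (hb.abs_log_fixedWealth_le hh hv c2 hb.le le_rfl hy)).2
  have hp := blockWeight_pos d N
  have hε := sideWeight_pos d N
  have hε' := hb.side
  have q1 := hb.fixedWealth_pos hv c1 N y
  have q2 := hb.fixedWealth_pos hv c2 N y
  have q3 := hb.fixedWealth_pos hv c3 N y
  have hH : 0 ≤ hedgeSum h A N y := sum_nonneg fun _ _ => hh.hedge_nonneg _ _
  have hN := hb.natCast_pos
  have hL := hb.one_le_log_log
  have herr := hb.error
  -- The exponents differ by `d * u - (2 * d - 5 * d ^ 2) * τ`. With `u ≤ 2 * (1 - 5 * d) * L` and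
  -- `τ ≥ (1 - d) * L` this is at most `-3 * d ^ 2 * L`: one third pays for `sideWeight`, the rest
  -- for the two errors `B ≤ d ^ 2 * L`.
  have key : fixedWealth v ((1 - 2 * d) * optFraction v N) A N y ≤
      sideWeight d N * fixedWealth v ((1 - 3 * d) * optFraction v N) A N y := by
    rw [← Real.exp_log q2, ← Real.exp_log q3, sideWeight, ← Real.exp_add]
    refine Real.exp_le_exp.2 ?_
    have hu : optFraction v N * ∑ i ∈ Ico A N, y i ≤ (1 - 5 * d) * (2 * Real.log (Real.log N)) := by
      have h0 : 0 ≤ optFraction v N := Real.sqrt_nonneg _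
      refine (mul_le_mul_of_nonneg_left hS h0).trans (le_of_eq ?_)
      rw [mul_left_comm]
      congr 1
      rw [optFraction, ← Real.sqrt_mul hv.le, ← Real.sqrt_mul (by positivity),
        Real.sqrt_eq_iff_mul_self_eq (by positivity) (by positivity)]
      field_simp
    have hτ : (1 - d) * Real.log (Real.log N) ≤
        optFraction v N ^ 2 * v / 2 * (N - A : ℕ) := by
      have h2 := hb.optFraction_sq hv
      have h3 : (1 - d) * N ≤ ((N - A : ℕ) : ℝ) := by
        rw [Nat.cast_sub hb.le]; linarith [hb.start_le]
      have := mul_le_mul_of_nonneg_left h3 (show 0 ≤ optFraction v N ^ 2 * v / 2 by positivity)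
      have h4 : optFraction v N ^ 2 * v / 2 * ((1 - d) * N) = (1 - d) * Real.log (Real.log N) := by
        linear_combination (1 - d) / 2 * h2
      rwa [h4] at this
    set L := Real.log (Real.log N)
    set B := blockError v
    set u := optFraction v N * ∑ i ∈ Ico A N, y i
    set τ := optFraction v N ^ 2 * v / 2 * (N - A : ℕ)
    have h1 := mul_le_mul_of_nonneg_left hu hd.le
    have h2 := mul_le_mul_of_nonneg_left hτ (show 0 ≤ 2 * d - 5 * d ^ 2 by nlinarith)
    have h3 : 0 ≤ d ^ 3 * L := by positivity
    linarith
  have k1 : blockWeight d N * (fixedWealth v ((1 - 2 * d) * optFraction v N) A N y -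
        sideWeight d N * fixedWealth v ((1 - d) * optFraction v N) A N y -
        sideWeight d N * fixedWealth v ((1 - 3 * d) * optFraction v N) A N y) ≤ 0 := by
    refine mul_nonpos_of_nonneg_of_nonpos hp.le ?_
    have := mul_pos hε q1
    linarith
  have k2 : blockWeight d N / 2 ≤ blockWeight d N * (1 - 2 * sideWeight d N) := by nlinarith
  linarith

end GoodBlock

/-! ### The lower bound: chaining the blocks -/

theorem exists_sum_Ico_le {f : ℕ → ℝ} (hf : Summable f) {ε : ℝ} (hε : 0 < ε) :
    ∃ n₁, ∀ a b, n₁ ≤ a → ∑ i ∈ Ico a b, f i ≤ ε := by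
  obtain ⟨s, hs⟩ := summable_iff_vanishing_norm.1 hf ε hε
  refine ⟨s.sup id + 1, fun a b ha => (le_abs_self _).trans (hs _ ?_).le⟩
  rw [Finset.disjoint_left]
  intro i hi his
  have h1 : i ≤ s.sup id := le_sup (f := id) his
  have := (mem_Ico.1 hi).1
  omega

theorem tendsto_optFraction {v : ℝ} : Tendsto (optFraction v) atTop (𝓝 0) := by
  have h1 := ((tendsto_log_log_pow_div_natCast 1).const_mul (2 / v)).sqrt
  rw [mul_zero, Real.sqrt_zero] at h1
  refine h1.congr fun n => ?_
  rw [optFraction, pow_one, mul_div_mul_comm]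

theorem eventually_goodBlock {h : ℝ → ℝ} (ha : Summable fun n => 1 / h (jumpBound n)) {v w d : ℝ}
    (hw : 0 ≤ w) (hd : 0 < d) {C : ℕ} (hC : 1 / d ≤ C) (hC2 : 2 ≤ C) :
    ∀ᶠ k in atTop, GoodBlock h v w d (C ^ k) (C ^ (k + 1)) := by
  have hA : Tendsto (fun k => C ^ k) atTop atTop :=
    tendsto_pow_atTop_atTop_of_one_lt (by omega)
  have hN : Tendsto (fun k => C ^ (k + 1)) atTop atTop := hA.comp (tendsto_add_atTop_nat 1)
  have hLL := tendsto_log_log_natCast_atTop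
  obtain ⟨n₁, hn₁⟩ := exists_sum_Ico_le ha (ε := 1 / (4 * (1 + w))) (by positivity)
  have e5 : ∀ᶠ n : ℕ in atTop, optFraction v n ^ 2 * v ≤ 1 / 2 := by
    have := ((tendsto_optFraction (v := v)).pow 2).mul_const v
    rw [zero_pow two_ne_zero, zero_mul] at this
    exact this.eventually_le_const (by norm_num)
  have e7 : ∀ᶠ n : ℕ in atTop, sideWeight d n ≤ 1 / 4 :=
    (Real.tendsto_exp_neg_atTop_nhds_zero.comp
      (hLL.const_mul_atTop (sq_pos_of_pos hd))).eventually_le_const (by norm_num)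
  have e8 : ∀ᶠ n : ℕ in atTop, blockError v ≤ d ^ 2 * Real.log (Real.log n) :=
    (hLL.const_mul_atTop (sq_pos_of_pos hd)).eventually_ge_atTop _
  have e9 : ∀ᶠ n : ℕ in atTop, Real.exp ((2 * blockError v + 2) / d + blockError v -
      d * Real.log (Real.log n)) * (2 + 2 / v) ≤ 1 / 4 := by
    have := ((Real.tendsto_exp_neg_atTop_nhds_zero.comp
      (tendsto_atTop_add_const_right _ (-((2 * blockError v + 2) / d + blockError v))
        (hLL.const_mul_atTop hd))).mul_const (2 + 2 / v)).eventually_le_const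
          (show 0 * (2 + 2 / v) < 1 / 4 by norm_num)
    filter_upwards [this] with n hn
    refine le_trans (le_of_eq ?_) hn
    simp only [Function.comp_apply]
    ring_nf
  filter_upwards [hA.eventually_ge_atTop 16, hA.eventually_ge_atTop n₁,
    hN.eventually (eventually_log_log_pow_le v),
    hN.eventually (tendsto_optFraction.eventually_le_const (zero_lt_one)), hN.eventually e5,
    hN.eventually e7, hN.eventually e8, hN.eventually e9] with k k1 k2 k3 k4 k5 k7 k8 k9
  refine ⟨k1, ?_, Nat.pow_le_pow_right (by omega) k.le_succ, k3, k4, k5, ?_, k7, k8, k9⟩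
  · rw [div_le_iff₀ hd] at hC
    push_cast
    rw [pow_succ]
    have : (0 : ℝ) ≤ (C : ℝ) ^ k := by positivity
    nlinarith
  · have := mul_le_mul_of_nonneg_left (hn₁ (C ^ k) (C ^ (k + 1)) k2) hw
    refine this.trans ?_
    rw [mul_one_div, div_le_div_iff₀ (by positivity) (by norm_num)]
    linarith

theorem predictable_blockBet (h : ℝ → ℝ) (v d : ℝ) (A N : ℕ → ℕ) :
    Predictable fun n y => blockBet h v d (A n) (N n) n y := by
  intro n y z hyz
  have h1 : ∀ i ∈ Ico (A n) n, y i = z i := fun i hi => hyz i (mem_Ico.1 hi).2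
  have h2 : hedgeSum h (A n) n y = hedgeSum h (A n) n z :=
    sum_congr rfl fun i hi => by rw [h1 i hi]
  have h3 : ∀ lam, fixedWealth v lam (A n) n y = fixedWealth v lam (A n) n z := fun lam =>
    prod_congr rfl fun i hi => by rw [h1 i hi]
  simp only [blockBet, h2, h3]

/-- The strategy `blockBet` in the blocks `C ^ k, …, C ^ (k + 1) - 1` for `k ≥ k₀`. -/
theorem exists_blockStrategy {h : ℝ → ℝ} (hh : IsExtraHedge h) {v w d : ℝ} (hv : 0 < v)
    (hw : 0 ≤ w) (hd : 0 < d) (hd' : d ≤ 1 / 8) {C k₀ : ℕ} (hC : 2 ≤ C) (hk₀ : 1 ≤ k₀)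
    (hgood : ∀ k ≥ k₀, GoodBlock h v w d (C ^ k) (C ^ (k + 1))) :
    ∃ t : ℕ → (ℕ → ℝ) → ℝ × ℝ × ℝ, Predictable t ∧ (∀ n < k₀, ∀ y, t n y = 0) ∧
      (∀ y n, 0 < wealth (payoff h v w) t y n) ∧ ∀ y, ∀ k ≥ k₀,
        wealth (payoff h v w) t y (C ^ (k + 1)) = wealth (payoff h v w) t y (C ^ k) *
          (1 + ∑ i ∈ Ico (C ^ k) (C ^ (k + 1)), payoff h v w (y i)
            (blockBet h v d (C ^ k) (C ^ (k + 1)) i y)) := by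
  let s : ℕ → (ℕ → ℝ) → ℝ × ℝ × ℝ := fun n y => if Nat.log C n < k₀ then 0 else
    blockBet h v d (C ^ Nat.log C n) (C ^ (Nat.log C n + 1)) n y
  have hs : Predictable s := by
    intro n y z hyz
    have h1 : blockBet h v d (C ^ Nat.log C n) (C ^ (Nat.log C n + 1)) n y =
        blockBet h v d (C ^ Nat.log C n) (C ^ (Nat.log C n + 1)) n z :=
      predictable_blockBet h v d (fun n => C ^ Nat.log C n) (fun n => C ^ (Nat.log C n + 1))
        n y z hyz
    simp only [s, h1]
  have hlog : ∀ {j i b}, i ∈ Ico (C ^ j) b → b ≤ C ^ (j + 1) → Nat.log C i = j :=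
    fun hi hb => Nat.log_eq_of_pow_le_of_lt_pow (mem_Ico.1 hi).1 ((mem_Ico.1 hi).2.trans_le hb)
  have hsum : ∀ (y : ℕ → ℝ) j b, k₀ ≤ j → b ≤ C ^ (j + 1) →
      ∑ i ∈ Ico (C ^ j) b, payoff h v w (y i) (s i y) =
      ∑ i ∈ Ico (C ^ j) b, payoff h v w (y i) (blockBet h v d (C ^ j) (C ^ (j + 1)) i y) := by
    intro y j b hj hb
    refine sum_congr rfl fun i hi => ?_
    simp only [s, hlog hi hb, if_neg (not_lt.2 hj)]
  have hsum0 : ∀ (y : ℕ → ℝ) j b, j < k₀ → b ≤ C ^ (j + 1) →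
      ∑ i ∈ Ico (C ^ j) b, payoff h v w (y i) (s i y) = 0 := by
    intro y j b hj hb
    refine sum_eq_zero fun i hi => ?_
    simp only [s, hlog hi hb, if_pos hj, map_zero]
  have hpos : ∀ (y : ℕ → ℝ) j b, C ^ j ≤ b → b ≤ C ^ (j + 1) →
      0 < 1 + ∑ i ∈ Ico (C ^ j) b, payoff h v w (y i) (s i y) := by
    intro y j b hb hb'
    rcases lt_or_ge j k₀ with hj | hj
    · rw [hsum0 y j b hj hb']; norm_num
    · rw [hsum y j b hj hb']
      have := (hgood j hj).half_le_blockWealth hh hv hw hd hd' hb hb' y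
      linarith
  -- Round 0 lies in no block `[C ^ k, C ^ (k + 1))` and forms one of its own, without bets.
  let c : ℕ → ℕ := fun n => if n = 0 then 0 else C ^ Nat.log C n
  have hs0 : ∀ n < k₀, ∀ y, s n y = 0 := fun n hn y => by
    have : Nat.log C n < k₀ := (Nat.log_le_self C n).trans_lt hn
    simp [s, this]
  obtain ⟨t, t1, t2, t3, t4⟩ := exists_wealth_blocks (payoff h v w) hs c
    (by
      intro y n
      rcases Nat.eq_zero_or_pos n with rfl | hn
      · simp
      · simp only [c, if_neg hn.ne']
        exact hpos y _ n (Nat.pow_log_le_self C hn.ne')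
          (Nat.lt_pow_succ_log_self (by omega) n).le)
    (by
      intro y n
      rcases Nat.eq_zero_or_pos n with rfl | hn
      · simp [c, hs0 0 (by omega) y]
      · simp only [c, if_neg hn.ne']
        exact hpos y _ (n + 1) ((Nat.pow_log_le_self C hn.ne').trans n.le_succ)
          (Nat.lt_pow_succ_log_self (by omega) n))
    (by
      intro n
      rcases Nat.eq_zero_or_pos n with rfl | hn
      · simp [c]
      · simp only [c, if_neg hn.ne']
        exact Nat.pow_log_le_self C hn.ne')
  refine ⟨t, t1, fun n hn y => t2 n y (hs0 n hn y), t3, fun y k hk => ?_⟩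
  rw [t4 y (C ^ k) (C ^ (k + 1)) (Nat.pow_le_pow_right (by omega) k.le_succ), hsum y k _ hk le_rfl]
  intro n hn
  have h0 : n ≠ 0 := by
    have := (mem_Ico.1 hn).1
    have : 0 < C ^ k := Nat.pow_pos (by omega)
    omega
  simp only [c, if_neg h0, hlog hn le_rfl]

theorem le_log_one_add {p c : ℝ} (hp : 0 ≤ p) (hp1 : p ≤ 1) (hc : 0 ≤ c) (hc1 : c ≤ 1 / 4) :
    p / 4 - 2 * c ≤ Real.log (1 + p / 2 - c) := by
  have h0 : 0 < 1 + p / 2 - c := by linarith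
  have h1 := Real.one_sub_inv_le_log_of_pos h0
  refine le_trans ?_ h1
  rw [le_sub_comm, inv_le_iff_one_le_mul₀ h0]
  nlinarith [mul_nonneg hp hc, mul_nonneg hp (sub_nonneg.2 hp1)]

/-- Dropping `d` leaves `exp (-ln ln N) = 1 / ln N`, a harmonic term for geometric block ends `N`.
-/
theorem inv_le_blockWeight {d : ℝ} (hd : 0 < d) {C : ℕ} {k : ℕ}
    (h16 : 16 ≤ C ^ (k + 1)) :
    1 / Real.log C * (1 / ((k : ℝ) + 1)) ≤ blockWeight d (C ^ (k + 1)) := by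
  have hL := one_le_log_log h16
  have hlog : 0 < Real.log ((C ^ (k + 1) : ℕ) : ℝ) := (Real.exp_pos 1).trans_le (exp_one_le_log h16)
  calc 1 / Real.log C * (1 / ((k : ℝ) + 1)) = 1 / Real.log ((C ^ (k + 1) : ℕ) : ℝ) := by
        rw [Nat.cast_pow, Real.log_pow, one_div_mul_one_div_rev]; norm_num
    _ = Real.exp (-Real.log (Real.log ((C ^ (k + 1) : ℕ) : ℝ))) := by
        rw [Real.exp_neg, Real.exp_log hlog, one_div]
    _ ≤ _ := Real.exp_le_exp.2 (by nlinarith)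

/-- If the conclusion fails, every late block multiplies the wealth by at least `1 + p / 2 - cost`,
where the weights `p` have a divergent sum and the costs a convergent one. The crude lower bound on
the sums is needed because the strategy only sees increments over a block. -/
theorem forcesLate_lower {h : ℝ → ℝ} (hh : IsExtraHedge h)
    (ha : Summable fun n => 1 / h (jumpBound n)) {v w d : ℝ} (hv : 0 < v)
    (hw : 0 ≤ w) (hd : 0 < d) (hd' : d ≤ 1 / 8) :
    ForcesLate (payoff h v w) {y | (Summable fun i => h (y i) * (1 / h (jumpBound i))) →
      (∀ᶠ n : ℕ in atTop,
        -1 * ∑ i ∈ range n, y i ≤ √v * √(2 * n * Real.log (Real.log n)) / (1 / 2)) →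
      ∃ᶠ n : ℕ in atTop,
        (1 - 6 * d) * (√v * √(2 * n * Real.log (Real.log n))) < ∑ i ∈ range n, y i} := by
  intro n₀
  -- With `4 ≤ d ^ 2 * C`, twice the critical value at the start of a block is at most `d` times
  -- that at its end, so the earlier moves change `1 - 6 * d` to `1 - 5 * d` at worst.
  obtain ⟨C, hC⟩ := exists_nat_ge (4 / d ^ 2 + 2)
  have hC2 : 2 ≤ C := by
    have : (2 : ℝ) ≤ C := le_trans (le_add_of_nonneg_left (by positivity)) hC
    exact_mod_cast this
  have hC4 : 4 ≤ d ^ 2 * C := by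
    have : 4 / d ^ 2 ≤ C := by linarith
    rwa [div_le_iff₀' (by positivity)] at this
  have hCd : 1 / d ≤ C := by
    rw [div_le_iff₀' hd]
    have : (0 : ℝ) ≤ C := by positivity
    nlinarith [mul_nonneg hd.le this]
  obtain ⟨K, hK⟩ := eventually_atTop.1 (eventually_goodBlock ha hw hd hCd hC2)
  obtain ⟨t, t1, t2, t3, t4⟩ := exists_blockStrategy hh hv hw hd hd' (k₀ := max (max n₀ 1) K) hC2
    ((le_max_right _ _).trans (le_max_left _ _)) fun k hk => hK k ((le_max_right _ _).trans hk)
  refine ⟨t, t1, fun n hn y => t2 n (hn.trans_le ((le_max_left _ _).trans (le_max_left _ _))) y,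
    fun y => ⟨fun n => (t3 y n).le, ?_⟩⟩
  rintro ⟨M, hM⟩ hy hlow
  by_contra hup
  rw [not_frequently] at hup
  simp only [not_lt] at hup
  have hA : Tendsto (fun k => C ^ k) atTop atTop := tendsto_pow_atTop_atTop_of_one_lt (by omega)
  have hN : Tendsto (fun k => C ^ (k + 1)) atTop atTop := hA.comp (tendsto_add_atTop_nat 1)
  obtain ⟨n₁, hn₁⟩ := exists_sum_Ico_le hy one_pos
  obtain ⟨k₁, hk₁⟩ := eventually_atTop.1 ((eventually_ge_atTop (max (max n₀ 1) K)).and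
    ((hA.eventually hlow).and ((hN.eventually hup).and (hA.eventually_ge_atTop n₁))))
  have hmono : ∀ k, C ^ k ≤ C ^ (k + 1) := fun k => Nat.pow_le_pow_right (by omega) k.le_succ
  have ha0 : ∀ i, 0 ≤ 1 / h (jumpBound i) := fun i => one_div_nonneg.2 (hh.nonneg _)
  have hstep : ∀ k ≥ k₁, Real.log (wealth (payoff h v w) t y (C ^ k)) +
      (blockWeight d (C ^ (k + 1)) / 4 -
        2 * (w * ∑ i ∈ Ico (C ^ k) (C ^ (k + 1)), 1 / h (jumpBound i))) ≤
      Real.log (wealth (payoff h v w) t y (C ^ (k + 1))) := by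
    intro k hk
    obtain ⟨h1, h2, h3, h4⟩ := hk₁ k hk
    have hb := hK k ((le_max_right _ _).trans h1)
    have hS : ∑ i ∈ Ico (C ^ k) (C ^ (k + 1)), y i ≤ (1 - 5 * d) *
        (√v * √(2 * (C ^ (k + 1) : ℕ) * Real.log (Real.log (C ^ (k + 1) : ℕ)))) := by
      have e1 := sum_range_add_sum_Ico y (hmono k)
      have e2 : √v * √(2 * (C ^ k : ℕ) * Real.log (Real.log (C ^ k : ℕ))) / (1 / 2) ≤
          d * (√v * √(2 * (C ^ (k + 1) : ℕ) * Real.log (Real.log (C ^ (k + 1) : ℕ)))) := by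
        have f1 := one_le_log_log hb.start
        have f2 := hb.one_le_log_log
        have f4 : (0 : ℝ) < (C ^ k : ℕ) := by exact_mod_cast Nat.pow_pos (by omega)
        have f3 : Real.log (Real.log (C ^ k : ℕ)) ≤ Real.log (Real.log (C ^ (k + 1) : ℕ)) := by
          have g1 : ((C ^ k : ℕ) : ℝ) ≤ (C ^ (k + 1) : ℕ) := by exact_mod_cast hmono k
          exact Real.log_le_log ((Real.exp_pos 1).trans_le (exp_one_le_log hb.start))
            (Real.log_le_log f4 g1)
        have f5 : 2 * √(2 * (C ^ k : ℕ) * Real.log (Real.log (C ^ k : ℕ))) ≤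
            d * √(2 * (C ^ (k + 1) : ℕ) * Real.log (Real.log (C ^ (k + 1) : ℕ))) := by
          rw [← Real.sqrt_sq hd.le, ← Real.sqrt_mul (sq_nonneg d),
            show (2 : ℝ) = √(2 ^ 2) by rw [Real.sqrt_sq (by norm_num)],
            ← Real.sqrt_mul (by positivity)]
          refine Real.sqrt_le_sqrt ?_
          rw [Real.sqrt_sq (by norm_num), pow_succ C k]
          push_cast at f4 f3 ⊢
          calc (2 : ℝ) ^ 2 * (2 * (C : ℝ) ^ k * Real.log (Real.log ((C : ℝ) ^ k)))
              = 4 * (2 * (C : ℝ) ^ k * Real.log (Real.log ((C : ℝ) ^ k))) := by norm_num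
            _ ≤ (d ^ 2 * C) * (2 * (C : ℝ) ^ k * Real.log (Real.log ((C : ℝ) ^ (k + 1)))) := by
              push_cast at f1
              gcongr
            _ = _ := by rw [pow_succ]; ring_nf
        have := mul_le_mul_of_nonneg_left f5 (Real.sqrt_nonneg v)
        linarith
      linarith
    have hend := hb.le_blockWealth_end hh hv hd hd' (hn₁ _ _ h4) hS
    have hp0 := blockWeight_pos d (C ^ (k + 1))
    have hp1 : blockWeight d (C ^ (k + 1)) ≤ 1 := by
      refine Real.exp_le_one_iff.2 ?_
      have := hb.one_le_log_log
      have : 0 ≤ (1 - d) * Real.log (Real.log (C ^ (k + 1) : ℕ)) :=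
        mul_nonneg (by linarith) (by linarith)
      linarith
    have hcost0 : 0 ≤ w * ∑ i ∈ Ico (C ^ k) (C ^ (k + 1)), 1 / h (jumpBound i) :=
      mul_nonneg hw (sum_nonneg fun i _ => ha0 i)
    have hlog := le_log_one_add hp0.le hp1 hcost0 hb.cost
    have hpos : 0 < 1 + blockWeight d (C ^ (k + 1)) / 2 -
        w * ∑ i ∈ Ico (C ^ k) (C ^ (k + 1)), 1 / h (jumpBound i) := by
      linarith [hb.cost]
    rw [t4 y k h1, Real.log_mul (t3 y _).ne' (hpos.trans_le hend).ne']
    have := Real.log_le_log hpos hend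
    linarith
  set T := ∑' i, 1 / h (jumpBound i)
  have hgrow : ∀ k ≥ k₁, Real.log (wealth (payoff h v w) t y (C ^ k₁)) +
      ∑ j ∈ Ico k₁ k, blockWeight d (C ^ (j + 1)) / 4 -
        2 * (w * ∑ i ∈ Ico (C ^ k₁) (C ^ k), 1 / h (jumpBound i)) ≤
      Real.log (wealth (payoff h v w) t y (C ^ k)) := by
    intro k hk
    induction k, hk using Nat.le_induction with
    | base => simp
    | succ k hk ih =>
      have e1 := hstep k hk
      rw [sum_Ico_succ_top hk,
        ← sum_Ico_consecutive _ (Nat.pow_le_pow_right (by omega) hk) (hmono k)]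
      linarith
  have hlogC : 0 < Real.log C := Real.log_pos (by exact_mod_cast (by omega : 1 < C))
  have hdiv : Tendsto (fun k => 1 / Real.log C / 4 * ∑ j ∈ range k, 1 / ((j : ℝ) + 1)) atTop atTop :=
    Real.tendsto_sum_range_one_div_nat_succ_atTop.const_mul_atTop (by positivity)
  obtain ⟨k, hkk, hk⟩ := ((eventually_ge_atTop k₁).and (hdiv.eventually_gt_atTop
    (Real.log M - Real.log (wealth (payoff h v w) t y (C ^ k₁)) + 2 * (w * T) +
      1 / Real.log C / 4 * ∑ j ∈ range k₁, 1 / ((j : ℝ) + 1)))).exists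
  have e1 := hgrow k hkk
  have e2 : ∑ i ∈ Ico (C ^ k₁) (C ^ k), 1 / h (jumpBound i) ≤ T :=
    ha.sum_le_tsum _ fun i _ => ha0 i
  have e3 : Real.log (wealth (payoff h v w) t y (C ^ k)) ≤ Real.log M :=
    Real.log_le_log (t3 y _) (hM ⟨_, rfl⟩)
  have e4 : 1 / Real.log C / 4 * ∑ j ∈ Ico k₁ k, 1 / ((j : ℝ) + 1) ≤
      ∑ j ∈ Ico k₁ k, blockWeight d (C ^ (j + 1)) / 4 := by
    rw [mul_sum]
    refine sum_le_sum fun j hj => ?_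
    have hb := hK j ((le_max_right _ _).trans (hk₁ j (mem_Ico.1 hj).1).1)
    have := inv_le_blockWeight hd (hb.start.trans hb.le)
    linarith
  have e5 := sum_range_add_sum_Ico (fun j : ℕ => 1 / ((j : ℝ) + 1)) hkk
  rw [← e5, mul_add] at hk
  have e6 := mul_le_mul_of_nonneg_left e2 hw
  linarith

/-! ### Assembling the law of the iterated logarithm -/

theorem limsup_coe_eq {u : ℕ → ℝ} {a : ℝ} {b c : ℕ → ℝ} (hb : Tendsto b atTop (𝓝 a))
    (hc : Tendsto c atTop (𝓝 a)) (h1 : ∀ j, ∀ᶠ n in atTop, u n ≤ b j)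
    (h2 : ∀ j, ∃ᶠ n in atTop, c j ≤ u n) : limsup (fun n => (u n : EReal)) atTop = a := by
  refine le_antisymm ?_ ?_
  · refine ge_of_tendsto' ((continuous_coe_real_ereal.tendsto a).comp hb) fun j => ?_
    exact limsup_le_of_le (by isBoundedDefault)
      ((h1 j).mono fun n hn => EReal.coe_le_coe_iff.2 hn)
  · refine le_of_tendsto' ((continuous_coe_real_ereal.tendsto a).comp hc) fun j => ?_
    exact le_limsup_of_frequently_le ((h2 j).mono fun n hn => EReal.coe_le_coe_iff.2 hn)
      (by isBoundedDefault)

theorem forcesLate_lil_of_pos {h : ℝ → ℝ} (hh : IsExtraHedge h)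
    (ha : Summable fun n => 1 / h (jumpBound n)) {v w : ℝ} (hv : 0 < v) (hw : 0 ≤ w) :
    ForcesLate (payoff h v w) (lilEvent 0 v) := by
  let r : ℕ → ℝ := fun j => 1 - 1 / 2 * (1 / ((j : ℝ) + 1))
  let d : ℕ → ℝ := fun j => 1 / 8 * (1 / ((j : ℝ) + 1))
  have hj0 : ∀ j : ℕ, 0 < 1 / ((j : ℝ) + 1) := fun j => by positivity
  have hj1 : ∀ j : ℕ, 1 / ((j : ℝ) + 1) ≤ 1 := fun j =>
    (div_le_one (by positivity)).2 (by linarith [Nat.cast_nonneg (α := ℝ) j])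
  have hr0 : ∀ j, 0 < r j := fun j => by simp only [r]; linarith [hj1 j]
  have hr1 : ∀ j, r j < 1 := fun j => by simp only [r]; linarith [hj0 j]
  have hd0 : ∀ j, 0 < d j := fun j => by simp only [d]; linarith [hj0 j]
  have hd1 : ∀ j, d j ≤ 1 / 8 := fun j => by simp only [d]; linarith [hj1 j]
  have hj := tendsto_one_div_add_atTop_nhds_zero_nat (𝕜 := ℝ)
  have hrt : Tendsto r atTop (𝓝 1) := by
    have := (hj.const_mul (1 / 2)).const_sub 1
    rwa [mul_zero, sub_zero] at this
  have hdt : Tendsto d atTop (𝓝 0) := by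
    have := hj.const_mul (1 / 8)
    rwa [mul_zero] at this
  have E1 := forcesLate_summable hh (v := v) hw ha
  have E2 := ForcesLate.iInter fun j =>
    forcesLate_upper hh (v := v) (w := w) hv (σ := 1) (by norm_num) (hr0 j) (hr1 j)
  -- Only a crude bound from below, with the factor 2, is needed here.
  have E3 := forcesLate_upper hh (v := v) (w := w) hv (σ := -1) (by norm_num)
    (show (0 : ℝ) < 1 / 2 by norm_num) (by norm_num)
  have E4 := ForcesLate.iInter fun j => forcesLate_lower hh ha hv hw (hd0 j) (hd1 j)
  refine ((E1.inter E2).inter (E3.inter E4)).mono ?_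
  rintro y ⟨⟨y1, y2⟩, y3, y4⟩
  rw [Set.mem_iInter] at y2 y4
  have hpos : ∀ᶠ n : ℕ in atTop, 0 < √(2 * n * Real.log (Real.log n)) := by
    filter_upwards [eventually_ge_atTop 16] with n hn
    have h1 := one_le_log_log hn
    have h2 : (0 : ℝ) < n := by exact_mod_cast (by omega : 0 < n)
    positivity
  refine limsup_coe_eq (b := fun j => √v / r j) (c := fun j => (1 - 6 * d j) * √v) ?_ ?_ ?_ ?_
  · have := (tendsto_const_nhds (x := √v)).div hrt one_ne_zero
    rwa [div_one] at this
  · simpa using ((hdt.const_mul 6).const_sub 1).mul_const √v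
  · intro j
    filter_upwards [y2 j y1, hpos] with n hn hp
    rw [div_le_iff₀ hp]
    rw [one_mul] at hn
    rw [zero_mul, sub_zero]
    exact hn.trans (le_of_eq (by ring))
  · intro j
    refine ((y4 j y1 (y3 y1)).and_eventually hpos).mono ?_
    rintro n ⟨hn, hp⟩
    rw [le_div_iff₀ hp, zero_mul, sub_zero]
    exact (le_of_eq (by ring)).trans hn.le

/-- At price 0 the tickets on `y ^ 2` are free, so bounded wealth means `∑ y i ^ 2 < ∞`; by
Cauchy–Schwarz the sums are then `O(√n)`. -/
theorem forcesLate_lil_zero (h : ℝ → ℝ) (w : ℝ) :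
    ForcesLate (payoff h 0 w) (lilEvent 0 0) := by
  intro n₀
  let s : ℕ → (ℕ → ℝ) → ℝ × ℝ × ℝ := fun n _ => if n < n₀ then 0 else (0, 1, 0)
  have hs : ∀ (y : ℕ → ℝ) i, payoff h 0 w (y i) (s i y) = if i < n₀ then 0 else y i ^ 2 := by
    intro y i
    simp only [s]
    split_ifs
    · simp
    · simp [payoff_apply]
  have hnn : ∀ (y : ℕ → ℝ) i, 0 ≤ payoff h 0 w (y i) (s i y) := fun y i => by
    rw [hs]; split_ifs; exacts [le_rfl, sq_nonneg _]
  refine ⟨s, fun _ _ _ _ => rfl, fun n hn y => by simp [s, hn], fun y => ⟨fun n =>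
    add_nonneg zero_le_one (sum_nonneg fun i _ => hnn y i), ?_⟩⟩
  rintro ⟨B, hB⟩
  have h1 : Summable fun i => payoff h 0 w (y i) (s i y) :=
    summable_of_sum_range_le (c := B) (hnn y) fun n => by
      have := hB ⟨n, rfl⟩
      rw [wealth] at this
      linarith
  have h2 : Summable fun i => y i ^ 2 := by
    refine (summable_congr_atTop ?_).1 h1
    filter_upwards [eventually_ge_atTop n₀] with i hi
    rw [hs, if_neg (not_lt.2 hi)]
  set T := ∑' i, y i ^ 2
  have hT : Tendsto (fun n : ℕ => √(T / 2 / Real.log (Real.log n))) atTop (𝓝 0) := by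
    simpa using (tendsto_log_log_natCast_atTop.const_div_atTop (T / 2)).sqrt
  have hlim : Tendsto (fun n : ℕ => ((∑ i ∈ range n, y i) - 0 * n) /
      √(2 * n * Real.log (Real.log n))) atTop (𝓝 0) := by
    refine squeeze_zero_norm' ?_ hT
    filter_upwards [eventually_ge_atTop 16] with n hn
    have hL := one_le_log_log hn
    have hn0 : (0 : ℝ) < n := by exact_mod_cast (by omega : 0 < n)
    have h3 : (∑ i ∈ range n, y i) ^ 2 ≤ n * T := by
      have := sq_sum_le_card_mul_sum_sq (s := range n) (f := y)
      rw [card_range] at this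
      refine this.trans ?_
      gcongr
      exact h2.sum_le_tsum _ fun i _ => sq_nonneg _
    refine Real.le_sqrt_of_sq_le ?_
    rw [zero_mul, sub_zero, Real.norm_eq_abs, sq_abs, div_pow, Real.sq_sqrt (by positivity),
      div_div, div_le_div_iff₀ (by positivity) (by positivity)]
    have := mul_le_mul_of_nonneg_right h3 (show 0 ≤ 2 * Real.log (Real.log n) by positivity)
    linarith
  have := ((continuous_coe_real_ereal.tendsto 0).comp hlim).limsup_eq
  simpa [lilEvent, Function.comp_def] using this

theorem forcesLate_lil {h : ℝ → ℝ} (hh : IsExtraHedge h)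
    (ha : Summable fun n => 1 / h (jumpBound n)) {v w : ℝ} (hv : 0 ≤ v) (hw : 0 ≤ w) :
    ForcesLate (payoff h v w) (lilEvent 0 v) := by
  rcases hv.eq_or_lt with rfl | hv
  · exact forcesLate_lil_zero h w
  · exact forcesLate_lil_of_pos hh ha hv hw

theorem centred_mem_lilEvent {x : ℕ → ℝ} {m v : ℝ} :
    (fun i => x i - m) ∈ lilEvent 0 v ↔ x ∈ lilEvent m v := by
  have : ∀ n : ℕ, ∑ i ∈ range n, (x i - m) - 0 * n = ∑ i ∈ range n, x i - m * n := fun n => by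
    rw [sum_sub_distrib]; simp; ring
  simp only [lilEvent, Set.mem_ofPred_eq, this]

end Proofs

end LILGame

theorem mainTheorem4 (h : ℝ → ℝ) (hh : LILGame.IsExtraHedge h)
    (hsum : Summable fun n : ℕ =>
      1 / h (√(((n + 3 : ℕ) : ℝ) / Real.log (Real.log ((n + 3 : ℕ) : ℝ)))))
    (m v w : ℝ) (hv : 0 ≤ v) (hw : 0 ≤ w)
    (hcoh : LILGame.Coherent h fun _ => ⟨m, v, w⟩)
    (m' v' : ℝ) (hv' : 0 ≤ v') :
    List.TFAE [
      m' = m ∧ v' = v,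
      LILGame.SkepticCanForce h (fun _ => ⟨m, v, w⟩) (LILGame.lilEvent m' v'),
      LILGame.RealityCanComply h (fun _ => ⟨m, v, w⟩) (LILGame.lilEvent m' v')] := by
  -- The three terms before `n = 3`, whatever their values, do not affect summability.
  have ha : Summable fun n => 1 / h (LILGame.jumpBound n) := (summable_nat_add_iff 3).1 hsum
  have hforce := LILGame.skepticCanForce_of_forcesLate (m := m) (LILGame.forcesLate_lil hh ha hv hw)
  simp only [LILGame.centred_mem_lilEvent] at hforce
  exact LILGame.tfae_of_skepticCanForce hv hcoh hforce hv'
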